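/- Let $d\ge 1$, let $\mu$ be Lebesgue measure on $\mathbb R^d$, and write $\langle f\rangle_q=\frac1{\mu(q)}\int_q f\,d\mu$. A locally integrable $f:\mathbb R^d\to\mathbb R$ is in BMO if $\frac1{\mu(q)}\int_q|f-\langle f\rangle_q|\,d\mu$ is bounded over all half-open axis-parallel boxes $q$ of positive measure; $\|f\|$ denotes the least bound. We say that $f$ satisfies the John--Nirenberg estimate with constants $C_1\ge1$, $C_2>0$ if $\mu(\{x\in q:|f(x)-\langle f\rangle_q|>r\})\le C_1\mu(q)e^{-r/(C_2\|f\|)}$ for all cubes $q$ and all $r>0$ (with the convention $r/0=0$). A real $\delta\ge0$ is $f$-admissible if $F^\delta=\{z\in\mathbb R:\mu(\{a\in[0,1)^d:f(a)>z\})=\delta\}$ is nonempty, and then $f^\delta=\inf F^\delta\in[-\infty,\infty)$. **Algorithm.** Fix $T\ge1$, $\epsilon,\eta\in(0,1)$, $D\ge0$, $C_1\ge 1$, $C_2>0$. Let $A_i,Y_i$ be the arm and the reward of round $i$, let $n_t(q)=\#\{i<t:A_i\in q\}$, and let $m_t(q)$ be the mean of the $Y_i$ with $i<t$ and $A_i\in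 q$ (and $0$ if there are none). Put $$\Psi=\max\{C_2\|f\|\log(C_1T^2/\epsilon),\,2\|f\|\log_2(1/\eta)\},\qquad H_t(q)=\frac{(\Psi+D)\sqrt{2\log(2T^2/\epsilon)}}{\sqrt{\max(1,n_t(q))}},\qquad J(q)=C_2\|f\|\log\frac{C_1\mu(q)}{\eta},$$ and $U_t=m_t+H_t+J$. (For $\|f\|=C_1=C_2=1$ these are $\Psi=\max\{\log(T^2/\epsilon),2\log_2(1/\eta)\}$ and $J(q)=\log(\mu(q)/\eta)$.) Set $\mathcal Q_0=\{[0,1)^d\}$. At the beginning of round $t\geq 1$ every cube $q$ of $\mathcal Q_{t-1}$ with $H_t(q)<J(q)$ is replaced by the $2^d$ dyadic cubes obtained by halving its edges, and this is repeated until $H_t\ge J$ on all cubes; the result is $\mathcal Q_t$. The algorithm picks $Q_t\in\arg\max_{q\in\mathcal Q_t}U_t(q)$ (ties broken in any way), draws $A_t$ uniformly from $Q_t$ given $\mathcal F_t=\sigma(Q_1,A_1,Y_1,\dots,Q_{t-1},A_{t-1},Y_{t-1},Q_t)$, and observes $Y_t$, where $|Y_t-f(A_t)|\le D$ almost surely and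 $\mathbb E[Y_t-f(A_t)\mid\mathcal F_t,A_t]=0$. The $\delta$-regret of round $t$ is $r_t^\delta=\max\{0,f^\delta-\mathbb E[f(A_t)\mid\mathcal F_t]\}$. **Theorem.** (i) There are $C_1\ge1$, $C_2>0$ depending only on $d$ such that every $f\in BMO(\mathbb R^d)$ satisfies the John--Nirenberg estimate with constants $C_1,C_2$. (ii) For all $C_1\ge1$, $C_2>0$, $b\ge0$, $D\ge0$ there is a constant $K$, depending only on $d,C_1,C_2,b,D$, such that the following holds for every $f\in BMO(\mathbb R^d)$ with $\|f\|=b$ and $\langle f\rangle_{[0,1)^d}=0$ that satisfies the John--Nirenberg estimate with constants $C_1,C_2$, for all $\epsilon,\eta\in(0,1)$ and $T\ge1$, and for every run of the algorithm. With probability at least $1-2\epsilon$, for every $f$-admissible $\delta>|\mathcal Q_T|\,\eta$ simultaneously, $$\sum_{t=1}^T r_t^\delta\le K(\Psi+D)\sqrt{2\log(2T^2/\epsilon)}\,\sqrt{T\,|\mathcal Q_T|\log\Bigl(1+(e-1)\frac{T}{|\mathcal Q_T|}\Bigr)},$$ that is, the total $\delta$-regret is $\widetilde O\bigl(\sqrt{T|\mathcal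 Q_T|}\bigr)$, where $\widetilde O$ hides constants and factors logarithmic in $T,1/\epsilon,1/\eta$. -/

import Mathlib

open MeasureTheory

namespace BMOBandit

noncomputable section

/-! Functions of bounded mean oscillation on `ℝ^d` -/

/-- The half-open axis-parallel box `∏ i, [a i, b i)`. -/
def box {d : ℕ} (a b : Fin d → ℝ) : Set (Fin d → ℝ) :=
  Set.univ.pi fun i => Set.Ico (a i) (b i)

/-- The arm space `[0,1)^d`. -/
def unitCube (d : ℕ) : Set (Fin d → ℝ) := box 0 1

/-- `C` bounds the mean oscillation of `f` over every nondegenerate box. -/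
def OscillationBound {d : ℕ} (f : (Fin d → ℝ) → ℝ) (C : ℝ) : Prop :=
  0 ≤ C ∧ ∀ a b : Fin d → ℝ, (∀ i, a i < b i) →
    ⨍ x in box a b, |f x - ⨍ y in box a b, f y| ≤ C

/-- `f ∈ BMO(ℝ^d, Lebesgue)`. -/
def IsBMO {d : ℕ} (f : (Fin d → ℝ) → ℝ) : Prop :=
  LocallyIntegrable f volume ∧ ∃ C, OscillationBound f C

/-- The BMO seminorm `‖f‖`: the infimum of the admissible oscillation bounds. -/
def bmoNorm {d : ℕ} (f : (Fin d → ℝ) → ℝ) : ℝ := sInf {C | OscillationBound f C}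

/-- `f` obeys the John--Nirenberg tail estimate with constants `C₁, C₂`:
`μ{x ∈ q : |f x - ⟨f⟩_q| > r} ≤ C₁ μ(q) exp(-r / (C₂ ‖f‖))` for all cubes `q` and all `r > 0`. -/
def JohnNirenberg {d : ℕ} (f : (Fin d → ℝ) → ℝ) (C₁ C₂ : ℝ) : Prop :=
  ∀ (a : Fin d → ℝ) (l : ℝ), 0 < l → ∀ r : ℝ, 0 < r →
    volume.real {x ∈ box a (fun i => a i + l) |
        r < |f x - ⨍ y in box a (fun i => a i + l), f y|}
      ≤ C₁ * volume.real (box a (fun i => a i + l)) * Real.exp (-r / (C₂ * bmoNorm f))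

/-! Admissible levels and the benchmark value -/

/-- The set `F^δ` of levels `z` with `μ{a ∈ [0,1)^d : f a > z} = δ`. -/
def levels {d : ℕ} (f : (Fin d → ℝ) → ℝ) (δ : ℝ) : Set ℝ :=
  {z | volume.real {a ∈ unitCube d | z < f a} = δ}

/-- `δ` is `f`-admissible. -/
def Admissible {d : ℕ} (f : (Fin d → ℝ) → ℝ) (δ : ℝ) : Prop :=
  0 ≤ δ ∧ (levels f δ).Nonempty

/-- `f^δ = inf F^δ`, as an extended real (it is `-∞` when `F^δ` is unbounded below, which can
happen for `δ = 1`). -/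
def benchmark {d : ℕ} (f : (Fin d → ℝ) → ℝ) (δ : ℝ) : EReal :=
  sInf ((fun z : ℝ => (z : EReal)) '' levels f δ)

/-! Dyadic cubes -/

/-- The pair `(k, m)` stands for the dyadic cube `∏ i, [m i / 2^k, (m i + 1) / 2^k)`. -/
abbrev Cube (d : ℕ) : Type := ℕ × (Fin d → ℕ)

/-- The set of points of a dyadic cube. -/
def Cube.toSet {d : ℕ} (q : Cube d) : Set (Fin d → ℝ) :=
  box (fun i => (q.2 i : ℝ) / 2 ^ q.1) (fun i => ((q.2 i : ℝ) + 1) / 2 ^ q.1)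

/-- The cube `[0,1)^d`. -/
def Cube.root (d : ℕ) : Cube d := (0, fun _ => 0)

/-- `c` is one of the `2^d` direct sub-cubes of `q`, obtained by halving all edges of `q`. -/
def Cube.IsSubcube {d : ℕ} (c q : Cube d) : Prop :=
  c.1 = q.1 + 1 ∧ ∀ i, c.2 i = 2 * q.2 i ∨ c.2 i = 2 * q.2 i + 1

/-- Lebesgue measure of a dyadic cube. -/
def Cube.meas {d : ℕ} (q : Cube d) : ℝ := volume.real q.toSet

/-! The algorithm -/

/-- The numbers the algorithm works with: the John--Nirenberg constants `C₁, C₂`, the BMO norm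
of the reward function, the noise bound `D`, the parameters `ε, η` and the horizon `T`. -/
structure Params where
  C₁ : ℝ
  C₂ : ℝ
  nrm : ℝ
  D : ℝ
  ε : ℝ
  η : ℝ
  T : ℕ

/-- `Ψ = max (C₂ ‖f‖ log (C₁ T² / ε)) (2 ‖f‖ log₂ (1/η))`. -/
def Params.Psi (p : Params) : ℝ :=
  max (p.C₂ * p.nrm * Real.log (p.C₁ * (p.T : ℝ) ^ 2 / p.ε))
    (2 * p.nrm * Real.logb 2 (1 / p.η))

open Classical in
/-- The rounds before round `t` (rounds are numbered from `1`) whose arm lies in `q`. -/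
def hits {d : ℕ} (a : ℕ → Fin d → ℝ) (t : ℕ) (q : Cube d) : Finset ℕ :=
  (Finset.Ico 1 t).filter fun i => a i ∈ q.toSet

/-- `n_t(q)`: the number of observations in `q` before round `t`. -/
def count {d : ℕ} (a : ℕ → Fin d → ℝ) (t : ℕ) (q : Cube d) : ℕ := (hits a t q).card

/-- `m_t(q)`: the average of the rewards observed in `q` before round `t`; it is `0` if there
are none. -/
def empMean {d : ℕ} (a : ℕ → Fin d → ℝ) (y : ℕ → ℝ) (t : ℕ) (q : Cube d) : ℝ :=
  (∑ i ∈ hits a t q, y i) / (count a t q : ℝ)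

/-- `H_t(q) = (Ψ + D) √(2 log (2 T² / ε)) / √(max 1 n_t(q))`. -/
def Params.H {d : ℕ} (p : Params) (a : ℕ → Fin d → ℝ) (t : ℕ) (q : Cube d) : ℝ :=
  (p.Psi + p.D) * Real.sqrt (2 * Real.log (2 * (p.T : ℝ) ^ 2 / p.ε)) /
    Real.sqrt (max 1 (count a t q : ℝ))

/-- `J(q) = C₂ ‖f‖ log (C₁ μ(q) / η)`. -/
def Params.J {d : ℕ} (p : Params) (q : Cube d) : ℝ :=
  p.C₂ * p.nrm * Real.log (p.C₁ * q.meas / p.η)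

/-- `U_t(q) = m_t(q) + H_t(q) + J(q)`. -/
def Params.U {d : ℕ} (p : Params) (a : ℕ → Fin d → ℝ) (y : ℕ → ℝ) (t : ℕ) (q : Cube d) : ℝ :=
  empMean a y t q + p.H a t q + p.J q

/-- `q` violates the partition rule `J(q) ≤ H_t(q)`. -/
def Params.Violates {d : ℕ} (p : Params) (a : ℕ → Fin d → ℝ) (t : ℕ) (q : Cube d) : Prop :=
  p.H a t q < p.J q

/-- The partition at round `t`. Start from `{[0,1)^d}`. Given the arms played before
round `t + 1`, keep replacing each violating cube by its direct sub-cubes, until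
no cube violates the rule; the result is the partition at round `t + 1`. -/
def Params.partition {d : ℕ} (p : Params) (a : ℕ → Fin d → ℝ) : ℕ → Set (Cube d)
  | 0 => {Cube.root d}
  | t + 1 => {q | (∃ q₀ ∈ p.partition a t,
      Relation.ReflTransGen (fun u v => p.Violates a (t + 1) u ∧ v.IsSubcube u) q₀ q) ∧
        ¬ p.Violates a (t + 1) q}

/-! Interaction of the algorithm with the environment -/

section Interaction

variable {Ω : Type*} {d : ℕ}

/-- `ℱ_t`: everything that is known immediately before the arm of round `t` is drawn, namely the
cubes, arms and rewards of the earlier rounds, and the cube selected in round `t`. -/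
def preArm (Q : ℕ → Ω → Cube d) (A : ℕ → Ω → Fin d → ℝ) (Y : ℕ → Ω → ℝ) (t : ℕ) :
    MeasurableSpace Ω :=
  (⨆ i ∈ Finset.Ico 1 t,
      MeasurableSpace.comap (fun ω => (Q i ω, A i ω, Y i ω)) inferInstance) ⊔
    MeasurableSpace.comap (Q t) inferInstance

/-- `ℱ'_t`: the same, together with the arm of round `t`. -/
def postArm (Q : ℕ → Ω → Cube d) (A : ℕ → Ω → Fin d → ℝ) (Y : ℕ → Ω → ℝ) (t : ℕ) :
    MeasurableSpace Ω :=
  preArm Q A Y t ⊔ MeasurableSpace.comap (A t) inferInstance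

/-- `Q, A, Y` are the selected cubes, the arms and the observed rewards when the algorithm with
parameters `p` is run for `p.T` rounds with the reward function `f`. -/
structure IsRun [mΩ : MeasurableSpace Ω] (P : Measure Ω) (p : Params) (f : (Fin d → ℝ) → ℝ)
    (Q : ℕ → Ω → Cube d) (A : ℕ → Ω → Fin d → ℝ) (Y : ℕ → Ω → ℝ) : Prop where
  measurable_cube : ∀ t, Measurable (Q t)
  measurable_arm : ∀ t, Measurable (A t)
  measurable_reward : ∀ t, Measurable (Y t)
  /-- The selected cube maximizes the index over the current partition (ties are broken in any
  way, possibly at random). -/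
  optimistic : ∀ t ∈ Finset.Icc 1 p.T, ∀ᵐ ω ∂P,
    Q t ω ∈ p.partition (fun i => A i ω) t ∧
      ∀ q ∈ p.partition (fun i => A i ω) t,
        p.U (fun i => A i ω) (fun i => Y i ω) t q ≤
          p.U (fun i => A i ω) (fun i => Y i ω) t (Q t ω)
  /-- The arm is drawn uniformly at random from the selected cube. -/
  uniform : ∀ t ∈ Finset.Icc 1 p.T, ∀ B : Set (Fin d → ℝ), MeasurableSet B →
    P[(A t ⁻¹' B).indicator (fun _ => (1 : ℝ)) | preArm Q A Y t] =ᵐ[P]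
      fun ω => volume.real (B ∩ (Q t ω).toSet) / (Q t ω).meas
  /-- The noise is bounded by `D`. -/
  noise_bounded : ∀ t ∈ Finset.Icc 1 p.T, ∀ᵐ ω ∂P, |Y t ω - f (A t ω)| ≤ p.D
  /-- The noise has mean zero given the past and the arm. -/
  noise_centered : ∀ t ∈ Finset.Icc 1 p.T,
    P[fun ω => Y t ω - f (A t ω) | postArm Q A Y t] =ᵐ[P] 0

/-- The `δ`-regret of round `t`: `r_t^δ = max (0, f^δ - 𝔼[f(A_t) | ℱ_t])`. -/
def regret [mΩ : MeasurableSpace Ω] (P : Measure Ω) (f : (Fin d → ℝ) → ℝ)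
    (Q : ℕ → Ω → Cube d) (A : ℕ → Ω → Fin d → ℝ) (Y : ℕ → Ω → ℝ) (δ : ℝ) (t : ℕ) (ω : Ω) :
    EReal :=
  max 0 (benchmark f δ - (((P[fun ω' => f (A t ω') | preArm Q A Y t]) ω : ℝ) : EReal))

end Interaction

end

end BMOBandit

/-! Regret bounds for bandits with reward functions of bounded mean oscillation. -/

namespace BMOBandit

/-! The regret bound rests on optimism. John–Nirenberg with `r = J(q)` says that `f` exceeds `⟨f⟩_q
+ J(q)` on at most measure `η` of a cube `q`. A level `z` above this value in each of `N` cells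
would have a superlevel set of measure at most `N η < δ`; hence `z ≤ ⟨f⟩_q + J(q)` for some cell
(`exists_level_le`). If the empirical means are within `H_t` of the true ones on all cells,
maximality of the index and `J ≤ H_t` bound the gap of the selected cube by three confidence widths
(`level_sub_le_of_optimistic`). Partitions are only refined, so earlier arms in the same final cell
as the current arm are counted by the current cube. Reciprocal visit numbers sum to a logarithm per
final cell, and Cauchy–Schwarz gives the square root (`sum_H_le`).

The confidence intervals are delicate because `f` is unbounded and the cells are chosen adaptively.
For a fixed dyadic cube `q`, an arm drawn uniformly from a larger cube is uniform on `q` once it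
lands in `q`. The exponential moments from John–Nirenberg therefore give an exponential
supermartingale for each `q` (`IsRun.lintegral_prod_factor_le`). All cells lie in a finite nonrandom
grid, and a union bound over cubes, rounds, visit numbers and signs costs at most `2ε` once the
confidence factor exceeds a constant `threshold`. Below that constant the horizon itself is bounded,
and the crude bound `O(Ψ)` per round is absorbed into `K` (`sum_level_sub_le`).

The John–Nirenberg estimate comes from iterating the Calderón–Zygmund decomposition: raising the
level by `2^d · 2‖f‖` halves the measure of the exceptional set (`distribution_decay`). -/

/-- The dyadic subcube with address `c` of the cube with corner `a` and side length `l`. -/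
def subcube {d : ℕ} (a : Fin d → ℝ) (l : ℝ) (c : Cube d) : Set (Fin d → ℝ) :=
  box (fun i => a i + l * (c.2 i / 2 ^ c.1)) (fun i => a i + l * (c.2 i / 2 ^ c.1) + l / 2 ^ c.1)

/-- The address of the dyadic subcube of generation `k` that contains `x`. -/
noncomputable def address {d : ℕ} (a : Fin d → ℝ) (l : ℝ) (k : ℕ) (x : Fin d → ℝ) : Cube d :=
  (k, fun i => ⌊(x i - a i) / l * 2 ^ k⌋.toNat)

/-! ### Geometry of dyadic cubes and averages over them. -/

section Geometry

variable {d : ℕ}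

lemma mem_box {a b x : Fin d → ℝ} : x ∈ box a b ↔ ∀ i, a i ≤ x i ∧ x i < b i := by
  simp [box]

lemma measurableSet_box (a b : Fin d → ℝ) : MeasurableSet (box a b) :=
  MeasurableSet.univ_pi fun _ => measurableSet_Ico

lemma volume_cube (a : Fin d → ℝ) {l : ℝ} (hl : 0 ≤ l) :
    volume (box a (fun i => a i + l)) = ENNReal.ofReal (l ^ d) := by
  rw [box, Real.volume_pi_Ico]
  simp [ENNReal.ofReal_pow hl]

lemma volume_real_cube (a : Fin d → ℝ) {l : ℝ} (hl : 0 ≤ l) :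
    volume.real (box a (fun i => a i + l)) = l ^ d := by
  rw [measureReal_def, volume_cube a hl, ENNReal.toReal_ofReal (by positivity)]

lemma integrableOn_box {f : (Fin d → ℝ) → ℝ} (hf : LocallyIntegrable f volume)
    (a b : Fin d → ℝ) : IntegrableOn f (box a b) volume :=
  (hf.integrableOn_isCompact (isCompact_Icc (a := a) (b := b))).mono_set fun x hx => by
    rw [mem_box] at hx
    exact ⟨fun i => (hx i).1, fun i => (hx i).2.le⟩

lemma integrableOn_toSet {f : (Fin d → ℝ) → ℝ} (hf : LocallyIntegrable f volume) (c : Cube d) :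
    IntegrableOn f c.toSet volume := integrableOn_box hf _ _

lemma measurableSet_subcube (a : Fin d → ℝ) (l : ℝ) (c : Cube d) :
    MeasurableSet (subcube a l c) := measurableSet_box _ _

lemma volume_real_subcube (a : Fin d → ℝ) {l : ℝ} (hl : 0 < l) (c : Cube d) :
    volume.real (subcube a l c) = (l / 2 ^ c.1) ^ d :=
  volume_real_cube _ (by positivity)

lemma volume_subcube (a : Fin d → ℝ) {l : ℝ} (hl : 0 < l) (c : Cube d) :
    volume (subcube a l c) = ENNReal.ofReal ((l / 2 ^ c.1) ^ d) :=
  volume_cube _ (by positivity)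

/-- Integer parts turn the dyadic combinatorics into arithmetic: uniqueness within a generation is
equality of integers, and nesting is integer division. -/
lemma mem_subcube {a : Fin d → ℝ} {l : ℝ} (hl : 0 < l) {c : Cube d} {x : Fin d → ℝ} :
    x ∈ subcube a l c ↔ ∀ i, ⌊(x i - a i) / l * 2 ^ c.1⌋ = (c.2 i : ℤ) := by
  rw [subcube, mem_box]
  refine forall_congr' fun i => ?_
  have h2 : (0 : ℝ) < 2 ^ c.1 := by positivity
  rw [Int.floor_eq_iff, Int.cast_natCast]
  have key : (x i - a i) / l * 2 ^ c.1 = ((x i - a i) * 2 ^ c.1) / l := by ring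
  rw [key, le_div_iff₀ hl, div_lt_iff₀ hl]
  have e1 : a i + l * (c.2 i / 2 ^ c.1) = a i + (c.2 i * l) / 2 ^ c.1 := by ring
  have e2 : a i + (c.2 i * l) / 2 ^ c.1 + l / 2 ^ c.1 = a i + ((c.2 i + 1) * l) / 2 ^ c.1 := by
    ring
  rw [e1, e2, ← le_sub_iff_add_le', ← sub_lt_iff_lt_add', div_le_iff₀ h2, lt_div_iff₀ h2]

lemma subcube_zero_zero (a : Fin d → ℝ) (l : ℝ) :
    subcube a l (0, fun _ => 0) = box a (fun i => a i + l) := by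
  simp [subcube]

lemma toSet_eq_subcube (c : Cube d) : c.toSet = subcube 0 1 c := by
  simp only [Cube.toSet, subcube, Pi.zero_apply, zero_add, one_mul, add_div]

lemma eq_of_mem_subcube {a : Fin d → ℝ} {l : ℝ} (hl : 0 < l) {c c' : Cube d} {x : Fin d → ℝ}
    (hx : x ∈ subcube a l c) (hx' : x ∈ subcube a l c') (h : c.1 = c'.1) : c = c' := by
  rw [mem_subcube hl] at hx hx'
  refine Prod.ext h (funext fun i => ?_)
  have := hx i
  rw [h, hx' i] at this
  exact_mod_cast this.symm

/-- Dropping the last `k - j` binary digits of the integer part gives the integer part at the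
coarser scale; nestedness of dyadic cubes follows from this. -/
lemma floor_mul_two_pow {j k : ℕ} (h : j ≤ k) (y : ℝ) :
    ⌊y * 2 ^ j⌋ = ⌊y * 2 ^ k⌋ / ((2 ^ (k - j) : ℕ) : ℤ) := by
  rw [← Int.mul_natCast_floor_div_cancel (n := 2 ^ (k - j)) (by positivity) (y * 2 ^ j)]
  congr 2
  push_cast
  rw [mul_assoc, ← pow_add, Nat.add_sub_cancel' h]

lemma subcube_subset_of_mem {a : Fin d → ℝ} {l : ℝ} (hl : 0 < l) {c c' : Cube d}
    {x : Fin d → ℝ} (hx : x ∈ subcube a l c) (hx' : x ∈ subcube a l c') (h : c.1 ≤ c'.1) :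
    subcube a l c' ⊆ subcube a l c := by
  intro y hy
  rw [mem_subcube hl] at *
  intro i
  rw [← hx i, floor_mul_two_pow h, floor_mul_two_pow h, hx' i, hy i]

lemma subcube_subset_ancestor {a : Fin d → ℝ} {l : ℝ} (hl : 0 < l) (c : Cube d) {k : ℕ}
    (h : k ≤ c.1) : subcube a l c ⊆ subcube a l (k, fun i => c.2 i / 2 ^ (c.1 - k)) := by
  intro y hy
  rw [mem_subcube hl] at *
  intro i
  simp only
  rw [floor_mul_two_pow h, hy i]
  push_cast
  rfl

lemma mem_cube_floor_nonneg {a : Fin d → ℝ} {l : ℝ} (hl : 0 < l) {x : Fin d → ℝ}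
    (hx : x ∈ box a (fun i => a i + l)) (k : ℕ) (i : Fin d) :
    0 ≤ ⌊(x i - a i) / l * 2 ^ k⌋ := by
  rw [mem_box] at hx
  have : 0 ≤ x i - a i := by linarith [(hx i).1]
  exact Int.floor_nonneg.2 (by positivity)

lemma mem_subcube_address {a : Fin d → ℝ} {l : ℝ} (hl : 0 < l) {x : Fin d → ℝ}
    (hx : x ∈ box a (fun i => a i + l)) (k : ℕ) : x ∈ subcube a l (address a l k x) := by
  rw [mem_subcube hl]
  intro i
  simp only [address]
  rw [Int.toNat_of_nonneg (mem_cube_floor_nonneg hl hx k i)]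

lemma subcube_subset_cube {a : Fin d → ℝ} {l : ℝ} (hl : 0 < l) {c : Cube d}
    {x : Fin d → ℝ} (hx : x ∈ box a (fun i => a i + l)) (hc : x ∈ subcube a l c) :
    subcube a l c ⊆ box a (fun i => a i + l) := by
  rw [← subcube_zero_zero] at hx ⊢
  exact subcube_subset_of_mem hl hx hc (Nat.zero_le _)

lemma corner_mem_subcube (a : Fin d → ℝ) {l : ℝ} (hl : 0 < l) (c : Cube d) :
    (fun i => a i + l * (c.2 i / 2 ^ c.1)) ∈ subcube a l c := by
  rw [subcube, mem_box]
  intro i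
  have : 0 < l / 2 ^ c.1 := by positivity
  exact ⟨le_rfl, by linarith⟩

lemma measurableSet_toSet (c : Cube d) : MeasurableSet c.toSet := measurableSet_box _ _

lemma Cube.meas_eq (c : Cube d) : c.meas = (1 / 2 ^ c.1) ^ d := by
  rw [Cube.meas, toSet_eq_subcube, volume_real_subcube 0 one_pos]

lemma Cube.meas_pos (c : Cube d) : 0 < c.meas := by
  rw [Cube.meas_eq]; positivity

lemma Cube.volume_eq (c : Cube d) : volume c.toSet = ENNReal.ofReal c.meas := by
  rw [Cube.meas_eq, toSet_eq_subcube, volume_subcube 0 one_pos]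

lemma Cube.volume_ne_top (c : Cube d) : volume c.toSet ≠ ⊤ := by
  rw [Cube.volume_eq]; exact ENNReal.ofReal_ne_top

lemma Cube.toSet_eq_cube (c : Cube d) :
    c.toSet = box (fun i => (c.2 i : ℝ) / 2 ^ c.1) (fun i => (c.2 i : ℝ) / 2 ^ c.1 + 1 / 2 ^ c.1) := by
  simp only [Cube.toSet, add_div]

lemma Cube.toSet_nonempty (c : Cube d) : c.toSet.Nonempty := by
  rw [toSet_eq_subcube]
  exact ⟨_, corner_mem_subcube 0 one_pos c⟩

lemma Cube.eq_of_mem {c c' : Cube d} {x : Fin d → ℝ} (hx : x ∈ c.toSet) (hx' : x ∈ c'.toSet)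
    (h : c.1 = c'.1) : c = c' := by
  rw [toSet_eq_subcube] at hx hx'
  exact eq_of_mem_subcube one_pos hx hx' h

lemma Cube.subset_of_mem {c c' : Cube d} {x : Fin d → ℝ} (hx : x ∈ c.toSet)
    (hx' : x ∈ c'.toSet) (h : c.1 ≤ c'.1) : c'.toSet ⊆ c.toSet := by
  simp only [toSet_eq_subcube] at *
  exact subcube_subset_of_mem one_pos hx hx' h

lemma unitCube_eq_cube : unitCube d = box (0 : Fin d → ℝ) (fun i => (0 : Fin d → ℝ) i + 1) := by
  simp only [unitCube, Pi.zero_apply, zero_add]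
  rfl

lemma Cube.root_toSet : (Cube.root d).toSet = unitCube d := by
  rw [toSet_eq_subcube, Cube.root, subcube_zero_zero, unitCube_eq_cube]

/-- The averages of `f` over a set and over a superset of comparable measure. -/
lemma abs_setAverage_sub_le {f : (Fin d → ℝ) → ℝ} {B B' : Set (Fin d → ℝ)} (hBB : B ⊆ B')
    (hB : 0 < volume.real B) (hBt : volume B' ≠ ⊤) {κ : ℝ}
    (hκ : volume.real B' = κ * volume.real B) (hf : IntegrableOn f B') (m : ℝ) :
    |(⨍ x in B, f x) - m| ≤ ⨍ x in B, |f x - m| ∧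
    ⨍ x in B, |f x - m| ≤ κ * ⨍ x in B', |f x - m| := by
  have hBt' : volume B ≠ ⊤ := ne_top_of_le_ne_top hBt (measure_mono hBB)
  have hfm : IntegrableOn (fun x => f x - m) B' := hf.sub (integrableOn_const hBt)
  have h1 : (⨍ x in B, f x) - m = ⨍ x in B, (f x - m) := by
    rw [setAverage_eq, setAverage_eq, integral_sub (hf.mono_set hBB) (integrableOn_const hBt')]
    simp only [smul_eq_mul, setIntegral_const]
    field_simp
  have h2 : |⨍ x in B, (f x - m)| ≤ ⨍ x in B, |f x - m| := by
    rw [setAverage_eq, setAverage_eq, smul_eq_mul, smul_eq_mul, abs_mul,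
      abs_of_nonneg (inv_nonneg.2 hB.le)]
    gcongr
    exact abs_integral_le_integral_abs
  have h3 : ⨍ x in B, |f x - m| ≤ κ * ⨍ x in B', |f x - m| := by
    have hκ' : κ ≠ 0 := by
      rintro rfl
      have : volume.real B ≤ volume.real B' := measureReal_mono hBB hBt
      rw [hκ] at this; linarith
    rw [setAverage_eq, setAverage_eq, smul_eq_mul, smul_eq_mul, hκ, mul_inv]
    have : κ * (κ⁻¹ * (volume.real B)⁻¹ * ∫ x in B', |f x - m|) =
        (volume.real B)⁻¹ * ∫ x in B', |f x - m| := by field_simp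
    rw [this]
    exact mul_le_mul_of_nonneg_left (setIntegral_mono_set hfm.abs
      (ae_of_all _ fun _ => abs_nonneg _) hBB.eventuallyLE) (by positivity)
  exact ⟨h1 ▸ h2, h3⟩

lemma oscillationBound_bmoNorm {f : (Fin d → ℝ) → ℝ} (hf : IsBMO f) :
    OscillationBound f (bmoNorm f) := by
  obtain ⟨C, hC⟩ := hf.2
  refine ⟨le_csInf ⟨C, hC⟩ fun _ h => h.1, fun a b hab => ?_⟩
  exact le_csInf ⟨C, hC⟩ fun _ h => h.2 a b hab

end Geometry

/-! ### The John–Nirenberg inequality. -/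

section JohnNirenberg

open Filter Topology

variable {d : ℕ}

/-- Cubes are balls of the sup metric up to a null boundary, so the Lebesgue differentiation theorem
for balls applies to dyadic averages. -/
lemma subcube_ae_eq_closedBall (a : Fin d → ℝ) {l : ℝ} (hl : 0 < l) (c : Cube d) :
    subcube a l c =ᵐ[volume] Metric.closedBall
      (fun i => a i + l * (c.2 i / 2 ^ c.1) + l / 2 ^ c.1 / 2) (l / 2 ^ c.1 / 2) := by
  have h : Metric.closedBall (fun i => a i + l * (c.2 i / 2 ^ c.1) + l / 2 ^ c.1 / 2)
      (l / 2 ^ c.1 / 2) = Set.Icc (fun i => a i + l * (c.2 i / 2 ^ c.1))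
        (fun i => a i + l * (c.2 i / 2 ^ c.1) + l / 2 ^ c.1) := by
    rw [closedBall_pi _ (by positivity), ← Set.pi_univ_Icc]
    congr 1
    funext i
    rw [Real.closedBall_eq_Icc]
    congr 1 <;> ring
  rw [h]
  exact Measure.univ_pi_Ico_ae_eq_Icc

/-- Calderón--Zygmund decomposition of a nonnegative function over the dyadic subcubes of a cube,
at twice (a bound of) its mean. -/
lemma calderon_zygmund {u : (Fin d → ℝ) → ℝ} (hu : LocallyIntegrable u volume) (hu0 : ∀ x, 0 ≤ u x)
    (a : Fin d → ℝ) {l : ℝ} (hl : 0 < l) {b : ℝ} (hb : 0 < b)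
    (havg : ⨍ x in box a (fun i => a i + l), u x ≤ b) :
    ∃ S : Set (Cube d), (∀ c ∈ S, subcube a l c ⊆ box a (fun i => a i + l)) ∧
      S.PairwiseDisjoint (subcube a l) ∧
      (∀ c ∈ S, ⨍ x in subcube a l c, u x ≤ 2 ^ d * (2 * b)) ∧
      volume.real (⋃ c ∈ S, subcube a l c) ≤ 2⁻¹ * volume.real (box a (fun i => a i + l)) ∧
      ∀ᵐ x, x ∈ box a (fun i => a i + l) → x ∉ (⋃ c ∈ S, subcube a l c) → u x ≤ 2 * b := by
  classical
  let B := box a (fun i => a i + l)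
  let bad : Cube d → Prop := fun c => 2 * b < ⨍ x in subcube a l c, u x
  -- The maximal bad cubes: having no bad ancestor makes them disjoint and bounds their averages
  -- through the parent.
  let S : Set (Cube d) := {c | subcube a l c ⊆ B ∧ bad c ∧
    ∀ c' : Cube d, c'.1 < c.1 → subcube a l c ⊆ subcube a l c' → ¬ bad c'}
  have hBint : IntegrableOn u B := integrableOn_box hu _ _
  have hBvol : 0 < volume.real B := by
    rw [volume_real_cube a hl.le]; positivity
  have hBt : volume B ≠ ⊤ := by rw [volume_cube a hl.le]; exact ENNReal.ofReal_ne_top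
  have hsub : ∀ c ∈ S, subcube a l c ⊆ B := fun c hc => hc.1
  have hdisj : S.PairwiseDisjoint (subcube a l) := by
    intro c hc c' hc' hne
    rw [Function.onFun, Set.disjoint_left]
    intro x hx hx'
    rcases lt_trichotomy c.1 c'.1 with h | h | h
    · exact hc'.2.2 c h (subcube_subset_of_mem hl hx hx' h.le) hc.2.1
    · exact hne (eq_of_mem_subcube hl hx hx' h)
    · exact hc.2.2 c' h (subcube_subset_of_mem hl hx' hx h.le) hc'.2.1
  have hmeas : ∀ c ∈ S, MeasurableSet (subcube a l c) := fun c _ => measurableSet_subcube a l c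
  have hU : (⋃ c ∈ S, subcube a l c) ⊆ B := Set.iUnion₂_subset hsub
  refine ⟨S, hsub, hdisj, ?_, ?_, ?_⟩
  · intro c hc
    -- The whole cube has mean at most `b < 2b`, so a bad cube has a parent.
    have hc0 : c.1 ≠ 0 := by
      intro h0
      have : subcube a l c = B := by
        have hx := corner_mem_subcube a hl c
        have hxB := hc.1 hx
        have : c = (0, fun _ => 0) := by
          have hxB' := hxB
          simp only [B, ← subcube_zero_zero] at hxB'
          exact eq_of_mem_subcube hl hx hxB' h0
        rw [this, subcube_zero_zero]
      have hbad : 2 * b < _ := hc.2.1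
      rw [this] at hbad
      linarith
    -- The parent is good; since `u ≥ 0`, passing to a child of `2^(-d)` times the volume multiplies
    -- the mean by at most `2^d`.
    obtain ⟨k, hk⟩ := Nat.exists_eq_succ_of_ne_zero hc0
    let p : Cube d := (k, fun i => c.2 i / 2 ^ (c.1 - k))
    have hcp : subcube a l c ⊆ subcube a l p := subcube_subset_ancestor hl c (by omega)
    have hp : ¬ bad p := hc.2.2 p (by simp only [p]; omega) hcp
    have hpB : IntegrableOn u (subcube a l p) := integrableOn_box hu _ _
    have h := (abs_setAverage_sub_le (f := u) hcp (by rw [volume_real_subcube a hl]; positivity)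
      (by rw [volume_subcube a hl]; exact ENNReal.ofReal_ne_top) (κ := 2 ^ d) (by
        rw [volume_real_subcube a hl, volume_real_subcube a hl, ← mul_pow, hk]
        congr 1
        simp only [p, Nat.succ_eq_add_one, pow_succ]
        field_simp) hpB 0).2
    simp only [sub_zero, abs_of_nonneg (hu0 _)] at h
    refine h.trans ?_
    gcongr
    exact not_lt.1 hp
  -- Chebyshev over the disjoint bad cubes: their total measure times `2b` is at most `∫_B u ≤ b
  -- μ(B)`.
  · have key : 2 * b * volume.real (⋃ c ∈ S, subcube a l c) ≤ ∫ x in B, u x := by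
      have h1 : ∀ c : S, ENNReal.ofReal (2 * b) * volume (subcube a l c) ≤
          ∫⁻ x in subcube a l c, ENNReal.ofReal (u x) := by
        intro c
        have hbad : 2 * b < ⨍ x in subcube a l c, u x := c.2.2.1
        have hv : 0 < volume.real (subcube a l c) := by
          rw [volume_real_subcube a hl]; positivity
        rw [setAverage_eq, smul_eq_mul, ← div_eq_inv_mul, lt_div_iff₀ hv] at hbad
        rw [← ofReal_integral_eq_lintegral_ofReal (hBint.mono_set c.2.1) (ae_of_all _ hu0)]
        have : volume (subcube a l c) = ENNReal.ofReal (volume.real (subcube a l c)) := by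
          rw [volume_subcube a hl, volume_real_subcube a hl]
        rw [this, ← ENNReal.ofReal_mul (by positivity)]
        exact ENNReal.ofReal_le_ofReal hbad.le
      have h2 : ENNReal.ofReal (2 * b) * volume (⋃ c ∈ S, subcube a l c) ≤
          ∫⁻ x in B, ENNReal.ofReal (u x) := by
        calc ENNReal.ofReal (2 * b) * volume (⋃ c ∈ S, subcube a l c)
            = ∑' c : S, ENNReal.ofReal (2 * b) * volume (subcube a l c) := by
              rw [measure_biUnion S.to_countable hdisj hmeas, ENNReal.tsum_mul_left]
          _ ≤ ∑' c : S, ∫⁻ x in subcube a l c, ENNReal.ofReal (u x) := ENNReal.tsum_le_tsum h1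
          _ = ∫⁻ x in ⋃ c ∈ S, subcube a l c, ENNReal.ofReal (u x) := by
              rw [lintegral_biUnion S.to_countable hmeas hdisj]
          _ ≤ _ := lintegral_mono_set hU
      rw [← ofReal_integral_eq_lintegral_ofReal hBint (ae_of_all _ hu0)] at h2
      have hUt : volume (⋃ c ∈ S, subcube a l c) ≠ ⊤ := ne_top_of_le_ne_top hBt (measure_mono hU)
      rw [← ENNReal.ofReal_toReal hUt, ← ENNReal.ofReal_mul (by positivity)] at h2
      rwa [ENNReal.ofReal_le_ofReal_iff (setIntegral_nonneg (measurableSet_box _ _)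
        fun x _ => hu0 x)] at h2
    rw [setAverage_eq, smul_eq_mul, ← div_eq_inv_mul, div_le_iff₀ hBvol] at havg
    have : 2 * b * volume.real (⋃ c ∈ S, subcube a l c) ≤ b * volume.real B := key.trans havg
    have : b * (2 * volume.real (⋃ c ∈ S, subcube a l c)) ≤ b * volume.real B := by linarith
    have := le_of_mul_le_mul_left this hb
    change _ ≤ 2⁻¹ * volume.real B
    linarith
  · filter_upwards [IsUnifLocDoublingMeasure.ae_tendsto_average volume hu 1] with x hx hxB hxU
    -- The first bad cube around `x` would belong to `S`. Off `S` all dyadic averages at `x` are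
    -- thus at most `2b`, and so is their limit `u x`.
    have hgood : ∀ k, ¬ bad (address a l k x) := by
      by_contra! hex
      let k := Nat.find hex
      have hk : bad (address a l k x) := Nat.find_spec hex
      have hmem := mem_subcube_address hl hxB
      refine hxU (Set.mem_iUnion₂.2 ⟨address a l k x, ⟨?_, hk, ?_⟩, hmem k⟩)
      · exact subcube_subset_cube hl hxB (hmem k)
      · intro c' hc' hsubc hbad
        have : c' = address a l c'.1 x := eq_of_mem_subcube hl (hsubc (hmem k)) (hmem _) rfl
        rw [this] at hbad
        exact Nat.find_min hex hc' hbad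
    have hlim := hx (fun k : ℕ => fun i => a i + l * ((address a l k x).2 i / 2 ^ k) + l / 2 ^ k / 2)
      (fun k : ℕ => l / 2 ^ k / 2) (l := atTop) ?_ ?_
    · refine le_of_tendsto hlim (Eventually.of_forall fun k => ?_)
      have h := setAverage_congr (f := u) (subcube_ae_eq_closedBall a hl (address a l k x))
      exact (h.symm.trans_le (not_lt.1 (hgood k)))
    · refine tendsto_nhdsWithin_iff.2 ⟨?_, Eventually.of_forall fun k => ?_⟩
      · have : Tendsto (fun k : ℕ => l / 2 * (1 / 2 : ℝ) ^ k) atTop (𝓝 (l / 2 * 0)) :=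
          (tendsto_pow_atTop_nhds_zero_of_lt_one (by norm_num) (by norm_num)).const_mul _
        rw [mul_zero] at this
        refine this.congr fun k => ?_
        rw [one_div, inv_pow]; ring
      · simp only [Set.mem_Ioi]; positivity
    · refine Eventually.of_forall fun k => ?_
      have hm := mem_subcube_address hl hxB k
      rw [subcube, mem_box] at hm
      rw [one_mul, closedBall_pi _ (by positivity), Set.mem_univ_pi]
      intro i
      rw [Real.closedBall_eq_Icc]
      have := hm i
      simp only [address] at this ⊢
      constructor <;> linarith [this.1, this.2]

/-- Geometric decay of the distribution function of `f` on every cube. -/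
lemma distribution_decay {f : (Fin d → ℝ) → ℝ} (hf : LocallyIntegrable f volume) {b : ℝ}
    (hb : 0 < b) (hosc : OscillationBound f b) (n : ℕ) :
    ∀ (a : Fin d → ℝ) (l : ℝ), 0 < l →
      volume.real {x ∈ box a (fun i => a i + l) |
        n * (2 ^ d * (2 * b)) < |f x - ⨍ y in box a (fun i => a i + l), f y|} ≤
      2⁻¹ ^ n * volume.real (box a (fun i => a i + l)) := by
  induction n with
  | zero =>
    intro a l hl
    rw [pow_zero, one_mul]
    exact measureReal_mono (fun x hx => hx.1)
      (by rw [volume_cube a hl.le]; exact ENNReal.ofReal_ne_top)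
  | succ n ih =>
    intro a l hl
    set B := box a (fun i => a i + l) with hB
    set m := ⨍ y in B, f y with hm
    have hBt : volume B ≠ ⊤ := by rw [hB, volume_cube a hl.le]; exact ENNReal.ofReal_ne_top
    have hu : LocallyIntegrable (fun x => |f x - m|) volume :=
      have h := hf.sub (locallyIntegrable_const m)
      h.mono h.aestronglyMeasurable.norm (ae_of_all _ fun x => by simp)
    obtain ⟨S, hSsub, hSd, hSavg, hSvol, hSae⟩ := calderon_zygmund hu (fun x => abs_nonneg _) a hl hb
      (hosc.2 a (fun i => a i + l) fun i => by linarith)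
    let c₀ : ℝ := 2 ^ d * (2 * b)
    have hc₀ : 0 < c₀ := by positivity
    have hc₀' : 2 * b ≤ c₀ := le_mul_of_one_le_left (by positivity) (one_le_pow₀ (by norm_num))
    let E : Cube d → Set (Fin d → ℝ) := fun c =>
      {x ∈ subcube a l c | n * c₀ < |f x - ⨍ y in subcube a l c, f y|}
    have hEvol : ∀ c, volume (E c) ≤ ENNReal.ofReal (2⁻¹ ^ n) * volume (subcube a l c) := by
      intro c
      have h := ih (fun i => a i + l * (c.2 i / 2 ^ c.1)) (l / 2 ^ c.1) (by positivity)
      have hct : volume (subcube a l c) ≠ ⊤ := by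
        rw [volume_subcube a hl]; exact ENNReal.ofReal_ne_top
      have hEt : volume (E c) ≠ ⊤ := ne_top_of_le_ne_top hct (measure_mono fun x hx => hx.1)
      rw [← ENNReal.ofReal_toReal hct, ← ENNReal.ofReal_mul (by positivity),
        ← ENNReal.ofReal_toReal hEt]
      exact ENNReal.ofReal_le_ofReal h
    -- Off the selected cubes `|f - m| ≤ 2b ≤ c₀`. On a selected cube the mean of `f` is within `c₀`
    -- of `m`, so a deviation of `(n + 1) c₀` from `m` leaves more than `n c₀` from the local mean,
    -- to which the induction hypothesis applies.
    have hcover : {x ∈ B | ((n + 1 : ℕ) : ℝ) * c₀ < |f x - m|} ≤ᵐ[volume] ⋃ c ∈ S, E c := by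
      filter_upwards [hSae] with x hx hxm
      obtain ⟨hxB, hxc⟩ := (hxm : x ∈ B ∧ _)
      push_cast at hxc
      have hxU : x ∈ ⋃ c ∈ S, subcube a l c := by
        by_contra hxU
        have := hx hxB hxU
        have h0 : 0 ≤ (n : ℝ) * c₀ := by positivity
        linarith
      obtain ⟨c, hcS, hxcc⟩ := Set.mem_iUnion₂.1 hxU
      refine Set.mem_iUnion₂.2 ⟨c, hcS, hxcc, ?_⟩
      have havg := (abs_setAverage_sub_le (f := f) (subset_refl (subcube a l c))
        (by rw [volume_real_subcube a hl]; positivity)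
        (by rw [volume_subcube a hl]; exact ENNReal.ofReal_ne_top) (one_mul _).symm
        (integrableOn_box hf _ _) m).1.trans (hSavg c hcS)
      have htri : |f x - m| ≤ |f x - ⨍ y in subcube a l c, f y| +
          |(⨍ y in subcube a l c, f y) - m| := by
        exact abs_sub_le _ _ _
      change _ ≤ c₀ at havg
      linarith
    have hfin : volume {x ∈ B | ((n + 1 : ℕ) : ℝ) * c₀ < |f x - m|} ≤
        ENNReal.ofReal (2⁻¹ ^ n) * volume (⋃ c ∈ S, subcube a l c) := by
      calc _ ≤ volume (⋃ c ∈ S, E c) := measure_mono_ae hcover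
        _ ≤ ∑' c : S, volume (E c) := measure_biUnion_le _ S.to_countable _
        _ ≤ ∑' c : S, ENNReal.ofReal (2⁻¹ ^ n) * volume (subcube a l c) :=
            ENNReal.tsum_le_tsum fun c => hEvol c
        _ = _ := by
            rw [measure_biUnion S.to_countable hSd fun c _ => measurableSet_subcube a l c,
              ENNReal.tsum_mul_left]
    have hUt : volume (⋃ c ∈ S, subcube a l c) ≠ ⊤ :=
      ne_top_of_le_ne_top hBt (measure_mono (Set.iUnion₂_subset hSsub))
    have hreal := ENNReal.toReal_mono (ENNReal.mul_ne_top ENNReal.ofReal_ne_top hUt) hfin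
    rw [ENNReal.toReal_mul, ENNReal.toReal_ofReal (by positivity)] at hreal
    change volume.real _ ≤ _ at hreal
    refine hreal.trans ?_
    rw [pow_succ, mul_assoc]
    exact mul_le_mul_of_nonneg_left hSvol (by positivity)

theorem exists_johnNirenberg (d : ℕ) : ∃ C₁ C₂ : ℝ, 1 ≤ C₁ ∧ 0 < C₂ ∧
    ∀ f : (Fin d → ℝ) → ℝ, IsBMO f → JohnNirenberg f C₁ C₂ := by
  have hlog : 0 < Real.log 2 := Real.log_pos (by norm_num)
  -- `C₂` rewrites `2^(-r/c₀)` as an exponential with `c₀ = 2^d · 2‖f‖`; `C₁ = 2` pays for rounding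
  -- `r / c₀` down to an integer.
  refine ⟨2, 2 ^ d * 2 / Real.log 2, by norm_num, by positivity, fun f hf a l hl r hr => ?_⟩
  have hosc := oscillationBound_bmoNorm hf
  have hv : 0 ≤ volume.real (box a (fun i => a i + l)) := measureReal_nonneg
  have hBt : volume (box a (fun i => a i + l)) ≠ ⊤ := by
    rw [volume_cube a hl.le]; exact ENNReal.ofReal_ne_top
  rcases hosc.1.eq_or_lt with h0 | hb
  -- For zero seminorm the exponent is `-r / 0 = 0` and the estimate is trivial.
  · rw [← h0, mul_zero, div_zero, Real.exp_zero, mul_one]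
    have := measureReal_mono (μ := volume) (fun x (hx : x ∈ {x ∈ box a (fun i => a i + l) |
        r < |f x - ⨍ y in box a (fun i => a i + l), f y|}) => hx.1) hBt
    linarith
  · set c₀ : ℝ := 2 ^ d * (2 * bmoNorm f) with hc₀
    have hc₀pos : 0 < c₀ := by positivity
    set n := ⌊r / c₀⌋₊ with hn
    have hn1 : n * c₀ ≤ r := by
      rw [← le_div_iff₀ hc₀pos]; exact Nat.floor_le (by positivity)
    have hn2 : r / c₀ < n + 1 := Nat.lt_floor_add_one _
    have h := distribution_decay hf.1 hb hosc n a l hl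
    refine (measureReal_mono (s₂ := {x ∈ box a (fun i => a i + l) | n * c₀ <
      |f x - ⨍ y in box a (fun i => a i + l), f y|}) (fun x hx => ⟨hx.1, hn1.trans_lt hx.2⟩)
      (ne_top_of_le_ne_top hBt (measure_mono fun x hx => hx.1))).trans (h.trans ?_)
    rw [mul_right_comm]
    refine mul_le_mul_of_nonneg_right ?_ hv
    have e1 : -r / (2 ^ d * 2 / Real.log 2 * bmoNorm f) = -(r / c₀) * Real.log 2 := by
      rw [hc₀]; field_simp
    have e2 : (2⁻¹ : ℝ) ^ n = Real.exp (-(n : ℝ) * Real.log 2) := by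
      rw [neg_mul, ← Real.log_pow, Real.exp_neg, Real.exp_log (by positivity), inv_pow]
    rw [e1, e2]
    nth_rewrite 2 [← Real.exp_log (show (0 : ℝ) < 2 by norm_num)]
    rw [← Real.exp_add]
    apply Real.exp_le_exp.2
    nlinarith

end JohnNirenberg

/-! ### The tree of partitions. -/

/-- The ranges in which the algorithm is run. -/
structure Params.Valid (p : Params) : Prop where
  one_le_C₁ : 1 ≤ p.C₁
  C₂_pos : 0 < p.C₂
  nrm_nonneg : 0 ≤ p.nrm
  D_nonneg : 0 ≤ p.D
  ε_pos : 0 < p.ε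
  ε_lt_one : p.ε < 1
  η_pos : 0 < p.η
  η_lt_one : p.η < 1
  one_le_T : 1 ≤ p.T

/-- The confidence factor `√(2 log (2 T² / ε))`. -/
noncomputable def Params.conf (p : Params) : ℝ :=
  Real.sqrt (2 * Real.log (2 * (p.T : ℝ) ^ 2 / p.ε))

/-- Strict bound on the generation and on the indices of the cubes in every partition. -/
noncomputable def Params.gridSize (p : Params) (d : ℕ) : ℕ := ⌈2 ^ d * p.C₁ / p.η⌉₊

/-- The cubes whose generation and indices are below `R`. -/
def cubesBelow (d R : ℕ) : Finset (Cube d) :=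
  Finset.range R ×ˢ Fintype.piFinset fun _ => Finset.range R

lemma card_cubesBelow (d R : ℕ) : (cubesBelow d R).card = R ^ (d + 1) := by
  simp [cubesBelow, pow_succ, mul_comm]

section Partition

variable {d : ℕ} {p : Params} {a : ℕ → Fin d → ℝ}

lemma Params.Valid.one_le_T_real (hp : p.Valid) : (1 : ℝ) ≤ p.T := by exact_mod_cast hp.one_le_T

lemma Params.Valid.Psi_nonneg (hp : p.Valid) : 0 ≤ p.Psi := by
  refine le_max_of_le_right ?_
  have h1 : 1 ≤ 1 / p.η := by rw [le_div_iff₀ hp.η_pos]; linarith [hp.η_lt_one]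
  have := Real.logb_nonneg (b := 2) (by norm_num) h1
  have := hp.nrm_nonneg
  positivity

lemma Params.Valid.H_nonneg (hp : p.Valid) (t : ℕ) (q : Cube d) : 0 ≤ p.H a t q := by
  have := hp.Psi_nonneg
  have := hp.D_nonneg
  unfold Params.H
  positivity

/-- Since `H ≥ 0`, a violation needs `J(q) > 0`, that is `C₁ μ(q) > η`: only cubes that are not too
small are ever split. -/
lemma Params.Valid.lt_of_violates (hp : p.Valid) {t : ℕ} {q : Cube d} (h : p.Violates a t q) :
    2 ^ (d * q.1) * p.η < p.C₁ := by
  have hJ : 0 < p.J q := (hp.H_nonneg t q).trans_lt h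
  have hη := hp.η_pos
  have hC := hp.one_le_C₁
  have hm := q.meas_pos
  have h1 : 1 < p.C₁ * q.meas / p.η := by
    by_contra! hle
    have := Real.log_nonpos (by positivity) hle
    have : p.J q ≤ 0 := mul_nonpos_of_nonneg_of_nonpos
      (mul_nonneg hp.C₂_pos.le hp.nrm_nonneg) this
    linarith
  rw [lt_div_iff₀ hη, one_mul, Cube.meas_eq, one_div, inv_pow, ← pow_mul, mul_comm q.1,
    ← div_eq_mul_inv, lt_div_iff₀ (by positivity)] at h1
  linarith

lemma Cube.IsSubcube.toSet_subset {c q : Cube d} (h : c.IsSubcube q) : c.toSet ⊆ q.toSet := by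
  have := subcube_subset_ancestor (a := 0) one_pos c (k := q.1) (by rw [h.1]; omega)
  rw [toSet_eq_subcube, toSet_eq_subcube]
  convert this using 2
  refine Prod.ext rfl (funext fun i => ?_)
  have h1 : c.1 - q.1 = 1 := by rw [h.1]; omega
  simp only [h1, pow_one]
  have := h.2 i
  omega

lemma Cube.exists_isSubcube_mem {q : Cube d} {x : Fin d → ℝ} (hx : x ∈ q.toSet) :
    ∃ c : Cube d, c.IsSubcube q ∧ x ∈ c.toSet := by
  rw [toSet_eq_subcube, mem_subcube one_pos] at hx
  have key : ∀ i, ⌊(x i - (0 : Fin d → ℝ) i) / 1 * 2 ^ (q.1 + 1)⌋ / 2 = (q.2 i : ℤ) := by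
    intro i
    rw [← hx i, floor_mul_two_pow (Nat.le_succ q.1)]
    simp
  refine ⟨(q.1 + 1, fun i => ⌊(x i - (0 : Fin d → ℝ) i) / 1 * 2 ^ (q.1 + 1)⌋.toNat),
    ⟨rfl, fun i => ?_⟩, ?_⟩
  · have := key i
    simp only
    omega
  · rw [toSet_eq_subcube, mem_subcube one_pos]
    intro i
    have := key i
    simp only
    omega

/-- This is what makes the splitting stop. It needs `0 < d`, because otherwise halving does not
shrink the measure. -/
lemma Params.Valid.exists_bound_violates (hp : p.Valid) (hd : 0 < d) :
    ∃ L : ℕ, ∀ (t : ℕ) (q : Cube d), p.Violates a t q → q.1 < L := by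
  refine ⟨⌈p.C₁ / p.η⌉₊, fun t q h => ?_⟩
  have h1 := hp.lt_of_violates h
  rw [← lt_div_iff₀ hp.η_pos] at h1
  have h2 : (q.1 : ℝ) < 2 ^ (d * q.1) := by
    have : q.1 < 2 ^ (d * q.1) :=
      Nat.lt_two_pow_self.trans_le (Nat.pow_le_pow_right (by norm_num) (Nat.le_mul_of_pos_left _ hd))
    exact_mod_cast this
  exact Nat.lt_ceil.2 (h2.trans h1)

lemma exists_terminal (hp : p.Valid) (hd : 0 < d) (t : ℕ) {q : Cube d} {x : Fin d → ℝ}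
    (hx : x ∈ q.toSet) :
    ∃ q' : Cube d, Relation.ReflTransGen (fun u v => p.Violates a t u ∧ v.IsSubcube u) q q' ∧
      ¬ p.Violates a t q' ∧ x ∈ q'.toSet := by
  obtain ⟨L, hL⟩ := hp.exists_bound_violates (a := a) hd
  induction h : L - q.1 generalizing q with
  | zero => exact ⟨q, .refl, fun hv => by have := hL t q hv; omega, hx⟩
  | succ n ih =>
    by_cases hv : p.Violates a t q
    · obtain ⟨c, hc, hxc⟩ := Cube.exists_isSubcube_mem hx
      obtain ⟨q', h1, h2, h3⟩ := ih hxc (by rw [hc.1]; omega)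
      exact ⟨q', .head ⟨hv, hc⟩ h1, h2, h3⟩
    · exact ⟨q, .refl, hv, hx⟩

lemma toSet_subset_of_reflTransGen {t : ℕ} {q q' : Cube d}
    (h : Relation.ReflTransGen (fun u v => p.Violates a t u ∧ v.IsSubcube u) q q') :
    q'.toSet ⊆ q.toSet := by
  induction h with
  | refl => exact subset_rfl
  | tail _ h ih => exact h.2.toSet_subset.trans ih

/-- Both chains follow the unique branch of subcubes containing `x` and stop at its first cube that
does not violate the rule. -/
lemma terminal_unique {t : ℕ} {q q₁ q₂ : Cube d} {x : Fin d → ℝ}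
    (h₁ : Relation.ReflTransGen (fun u v => p.Violates a t u ∧ v.IsSubcube u) q q₁)
    (h₂ : Relation.ReflTransGen (fun u v => p.Violates a t u ∧ v.IsSubcube u) q q₂)
    (hv₁ : ¬ p.Violates a t q₁) (hv₂ : ¬ p.Violates a t q₂)
    (hx₁ : x ∈ q₁.toSet) (hx₂ : x ∈ q₂.toSet) : q₁ = q₂ := by
  induction h₁ using Relation.ReflTransGen.head_induction_on with
  | refl =>
    rcases h₂.cases_head with h | ⟨c, hc, -⟩
    · exact h
    · exact absurd hc.1 hv₁
  | head h hr ih =>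
    rcases h₂.cases_head with h' | ⟨c, hc, hcr⟩
    · subst h'; exact absurd h.1 hv₂
    · refine ih ?_
      have : c = _ := Cube.eq_of_mem (toSet_subset_of_reflTransGen hcr hx₂)
        (toSet_subset_of_reflTransGen hr hx₁) (by rw [hc.2.1, h.2.1])
      rwa [← this]

lemma exists_mem_partition (hp : p.Valid) (hd : 0 < d) (t : ℕ) {x : Fin d → ℝ}
    (hx : x ∈ unitCube d) : ∃ q ∈ p.partition a t, x ∈ q.toSet := by
  induction t with
  | zero => exact ⟨Cube.root d, rfl, by rwa [Cube.root_toSet]⟩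
  | succ t ih =>
    obtain ⟨q, hq, hxq⟩ := ih
    obtain ⟨q', h1, h2, h3⟩ := exists_terminal (a := a) hp hd (t + 1) hxq
    exact ⟨q', ⟨⟨q, hq, h1⟩, h2⟩, h3⟩

lemma partition_unique (t : ℕ) {q q' : Cube d} {x : Fin d → ℝ} (hq : q ∈ p.partition a t)
    (hq' : q' ∈ p.partition a t) (hx : x ∈ q.toSet) (hx' : x ∈ q'.toSet) : q = q' := by
  induction t generalizing q q' with
  | zero => rw [show q = Cube.root d from hq, show q' = Cube.root d from hq']
  | succ t ih =>
    obtain ⟨⟨u, hu, hr⟩, hv⟩ := hq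
    obtain ⟨⟨u', hu', hr'⟩, hv'⟩ := hq'
    have : u = u' := ih hu hu' (toSet_subset_of_reflTransGen hr hx)
      (toSet_subset_of_reflTransGen hr' hx')
    subst this
    exact terminal_unique hr hr' hv hv' hx hx'

lemma partition_refines {s t : ℕ} (h : s ≤ t) {q : Cube d} (hq : q ∈ p.partition a t) :
    ∃ q₀ ∈ p.partition a s, q.toSet ⊆ q₀.toSet := by
  induction t, h using Nat.le_induction generalizing q with
  | base => exact ⟨q, hq, subset_rfl⟩
  | succ t _ ih =>
    obtain ⟨⟨u, hu, hr⟩, -⟩ := hq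
    obtain ⟨q₀, h0, h1⟩ := ih hu
    exact ⟨q₀, h0, (toSet_subset_of_reflTransGen hr).trans h1⟩

lemma toSet_subset_unitCube {t : ℕ} {q : Cube d} (hq : q ∈ p.partition a t) :
    q.toSet ⊆ unitCube d := by
  obtain ⟨q₀, h0, h1⟩ := partition_refines (Nat.zero_le t) hq
  rwa [show q₀ = Cube.root d from h0, Cube.root_toSet] at h1

lemma toSet_subset_of_partition {s t : ℕ} (h : s ≤ t) {q q' : Cube d} {x : Fin d → ℝ}
    (hq : q ∈ p.partition a s) (hq' : q' ∈ p.partition a t) (hx : x ∈ q.toSet)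
    (hx' : x ∈ q'.toSet) : q'.toSet ⊆ q.toSet := by
  obtain ⟨q₀, h0, h1⟩ := partition_refines h hq'
  rwa [partition_unique s hq h0 hx (h1 hx')]

/-- The initial partition is never tested against the rule, hence the condition `1 ≤ t`. -/
lemma J_le_H_of_mem_partition {t : ℕ} (ht : 1 ≤ t) {q : Cube d} (hq : q ∈ p.partition a t) :
    p.J q ≤ p.H a t q := by
  obtain ⟨t, rfl⟩ := Nat.exists_eq_add_of_le' ht
  exact not_lt.1 hq.2

/-- A cell is the root or a child of a cube that violated the rule when it was split, which costs a
factor `2^d` over the bound for violating cubes. -/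
lemma generation_bound (hp : p.Valid) {t : ℕ} {q : Cube d} (hq : q ∈ p.partition a t) :
    2 ^ (d * q.1) * p.η < 2 ^ d * p.C₁ := by
  have hη := hp.η_pos
  have hC := hp.one_le_C₁
  induction t generalizing q with
  | zero =>
    rw [show q = Cube.root d from hq, Cube.root, Nat.mul_zero, pow_zero, one_mul]
    have : (1 : ℝ) ≤ 2 ^ d := one_le_pow₀ (by norm_num)
    nlinarith [hp.η_lt_one]
  | succ t ih =>
    obtain ⟨⟨u, hu, hr⟩, -⟩ := hq
    rcases hr.cases_tail with rfl | ⟨c, -, hc⟩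
    · exact ih hu
    · have h1 := hp.lt_of_violates hc.1
      rw [hc.2.1, mul_add, mul_one, pow_add]
      have : (0 : ℝ) < 2 ^ d := by positivity
      nlinarith

lemma index_lt {q : Cube d} (h : q.toSet ⊆ unitCube d) (i : Fin d) : q.2 i < 2 ^ q.1 := by
  have hc := h (show (fun i => (q.2 i : ℝ) / 2 ^ q.1) ∈ q.toSet by
    rw [Cube.toSet_eq_cube, mem_box]
    intro i
    have : (0 : ℝ) < 1 / 2 ^ q.1 := by positivity
    exact ⟨le_rfl, by linarith⟩)
  rw [unitCube, mem_box] at hc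
  have := (hc i).2
  rw [Pi.one_apply, div_lt_one (by positivity)] at this
  exact_mod_cast this

/-- The cells are random, but they all come from this finite nonrandom grid; this provides the
finite family for the union bound and for integrability. -/
lemma mem_cubesBelow (hp : p.Valid) (hd : 0 < d) {t : ℕ} {q : Cube d}
    (hq : q ∈ p.partition a t) : q ∈ cubesBelow d (p.gridSize d) := by
  have h1 := generation_bound hp hq
  rw [← lt_div_iff₀ hp.η_pos] at h1
  have h2 : 2 ^ q.1 < p.gridSize d := by
    refine Nat.lt_ceil.2 (lt_of_le_of_lt ?_ h1)
    push_cast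
    exact pow_le_pow_right₀ (by norm_num) (Nat.le_mul_of_pos_left _ hd)
  rw [cubesBelow, Finset.mem_product, Fintype.mem_piFinset]
  exact ⟨Finset.mem_range.2 (Nat.lt_two_pow_self.trans h2), fun i =>
    Finset.mem_range.2 ((index_lt (toSet_subset_unitCube hq) i).trans h2)⟩

lemma partition_finite (hp : p.Valid) (hd : 0 < d) (t : ℕ) : (p.partition a t).Finite :=
  (cubesBelow d (p.gridSize d)).finite_toSet.subset fun _ hq => mem_cubesBelow hp hd hq

/-- Choosing a finer cell inside each coarse cell is injective, because coarse cells are disjoint.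
-/
lemma ncard_partition_mono (hp : p.Valid) (hd : 0 < d) {s t : ℕ} (h : s ≤ t) :
    (p.partition a s).ncard ≤ (p.partition a t).ncard := by
  have hex : ∀ q ∈ p.partition a s, ∃ q' ∈ p.partition a t, q'.toSet ⊆ q.toSet := by
    intro q hq
    obtain ⟨x, hx⟩ := q.toSet_nonempty
    obtain ⟨q', hq', hx'⟩ := exists_mem_partition (a := a) hp hd t (toSet_subset_unitCube hq hx)
    exact ⟨q', hq', toSet_subset_of_partition h hq hq' hx hx'⟩
  choose! g hg hgs using hex
  refine Set.ncard_le_ncard_of_injOn g hg (fun q hq q' hq' he => ?_) (partition_finite hp hd t)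
  obtain ⟨x, hx⟩ := (g q).toSet_nonempty
  exact partition_unique s hq hq' (hgs q hq hx) (hgs q' hq' (he ▸ hx))

lemma one_le_ncard_partition (hp : p.Valid) (hd : 0 < d) (t : ℕ) :
    1 ≤ (p.partition a t).ncard := by
  have h := ncard_partition_mono (a := a) hp hd (Nat.zero_le t)
  rwa [show p.partition a 0 = {Cube.root d} from rfl, Set.ncard_singleton] at h

end Partition

/-! ### Averages and superlevel sets of BMO functions on the cells. -/

section Averages

variable {d : ℕ} {f : (Fin d → ℝ) → ℝ}

/-- The mean of a BMO function over a dyadic cube grows at most linearly in the generation. -/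
lemma abs_setAverage_le_generation (hf : IsBMO f) (h0 : ⨍ x in unitCube d, f x = 0)
    {q : Cube d} (hq : q.toSet ⊆ unitCube d) :
    |⨍ x in q.toSet, f x| ≤ q.1 * (2 ^ d * bmoNorm f) := by
  obtain ⟨k, m⟩ := q
  induction k generalizing m with
  | zero =>
    have : m = fun _ => 0 := funext fun i => by have := index_lt hq i; simpa using this
    subst this
    rw [show ((0, fun _ => 0) : Cube d) = Cube.root d from rfl, Cube.root_toSet, h0]
    simp [Cube.root]
  | succ k ih =>
    let c : Cube d := (k + 1, m)
    let r : Cube d := (k, fun i => m i / 2 ^ 1)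
    have hcr : c.toSet ⊆ r.toSet := by
      have := subcube_subset_ancestor (a := 0) one_pos c (k := k) (by simp [c])
      simpa only [toSet_eq_subcube, c, r, Nat.add_sub_cancel_left] using this
    have hr : r.toSet ⊆ unitCube d := by
      obtain ⟨x, hx⟩ := c.toSet_nonempty
      rw [← Cube.root_toSet]
      exact Cube.subset_of_mem (by rw [Cube.root_toSet]; exact hq hx) (hcr hx) (Nat.zero_le _)
    have h1 := ih _ hr
    have h2 := (abs_setAverage_sub_le (f := f) hcr c.meas_pos
      r.volume_ne_top (κ := 2 ^ d) (by
        change r.meas = _ * c.meas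
        rw [Cube.meas_eq, Cube.meas_eq, ← mul_pow]
        congr 1
        simp only [c, r, pow_succ]
        field_simp) (integrableOn_box hf.1 _ _) (⨍ x in r.toSet, f x))
    have h3 : ⨍ x in r.toSet, |f x - ⨍ y in r.toSet, f y| ≤ bmoNorm f := by
      rw [Cube.toSet_eq_cube]
      exact (oscillationBound_bmoNorm hf).2 _ _ fun i => by
        have : (0 : ℝ) < 1 / 2 ^ r.1 := by positivity
        linarith
    have h4 : |(⨍ x in c.toSet, f x) - ⨍ x in r.toSet, f x| ≤ 2 ^ d * bmoNorm f :=
      (h2.1.trans h2.2).trans (by gcongr)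
    have h5 := abs_sub_abs_le_abs_sub (⨍ x in c.toSet, f x) (⨍ x in r.toSet, f x)
    simp only [r] at h1 h4 h5
    push_cast
    simp only [c] at h4 h5
    linarith

/-- With zero seminorm the John–Nirenberg bound carries no information (`r / 0 = 0`), so this case
is read off from the vanishing oscillation. -/
lemma ae_eq_setAverage_of_bmoNorm_eq_zero (hf : IsBMO f) (h0 : bmoNorm f = 0) (q : Cube d) :
    ∀ᵐ x ∂volume.restrict q.toSet, f x = ⨍ y in q.toSet, f y := by
  have hv := q.meas_pos
  have h : ⨍ x in q.toSet, |f x - ⨍ y in q.toSet, f y| ≤ 0 := by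
    have := (oscillationBound_bmoNorm hf).2 (fun i => (q.2 i : ℝ) / 2 ^ q.1)
      (fun i => (q.2 i : ℝ) / 2 ^ q.1 + 1 / 2 ^ q.1) fun i => by
        have : (0 : ℝ) < 1 / 2 ^ q.1 := by positivity
        linarith
    rwa [← Cube.toSet_eq_cube, h0] at this
  rw [setAverage_eq, smul_eq_mul] at h
  have h1 : ∫ x in q.toSet, |f x - ⨍ y in q.toSet, f y| ≤ 0 := by
    by_contra! hpos
    have : 0 < (volume.real q.toSet)⁻¹ * ∫ x in q.toSet, |f x - ⨍ y in q.toSet, f y| :=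
      mul_pos (inv_pos.2 hv) hpos
    linarith
  have h2 : ∫ x in q.toSet, |f x - ⨍ y in q.toSet, f y| = 0 :=
    le_antisymm h1 (integral_nonneg fun _ => abs_nonneg _)
  have hint : Integrable (fun x => |f x - ⨍ y in q.toSet, f y|) (volume.restrict q.toSet) :=
    ((integrableOn_toSet hf.1 q).sub (integrableOn_const q.volume_ne_top)).abs
  rw [integral_eq_zero_iff_of_nonneg (fun _ => abs_nonneg _) hint] at h2
  filter_upwards [h2] with x hx
  have : |f x - ⨍ y in q.toSet, f y| = 0 := hx
  linarith [abs_eq_zero.1 this]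

/-- `J(q)` is the radius at which the John–Nirenberg bound equals `η`. If `‖f‖ > 0` and `J(q) ≤ 0`,
then `μ(q) ≤ C₁ μ(q) ≤ η` already. -/
lemma measure_superlevel_le {p : Params} (hp : p.Valid) (hf : IsBMO f) (hb : bmoNorm f = p.nrm)
    (hJN : JohnNirenberg f p.C₁ p.C₂) {q : Cube d} {z : ℝ}
    (hz : (⨍ x in q.toSet, f x) + p.J q < z) :
    volume.real {x ∈ q.toSet | z < f x} ≤ p.η := by
  have hη := hp.η_pos
  have hC := hp.one_le_C₁
  have hC2 := hp.C₂_pos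
  have hm := q.meas_pos
  have hqt : volume q.toSet ≠ ⊤ := q.volume_ne_top
  rcases hp.nrm_nonneg.eq_or_lt with h0 | hb0
  · have hJ : p.J q = 0 := by rw [Params.J, ← h0]; simp
    have hae := ae_eq_setAverage_of_bmoNorm_eq_zero hf (hb.trans h0.symm) q
    rw [ae_restrict_iff' (measurableSet_toSet q)] at hae
    have : volume {x ∈ q.toSet | z < f x} = 0 := by
      refine measure_mono_null (fun x hx => ?_) hae
      intro hx'
      have := hx' hx.1
      have := hx.2
      linarith
    rw [measureReal_def, this]
    simpa using hη.le
  · by_cases hJ : 0 < p.J q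
    · have h := hJN (fun i => (q.2 i : ℝ) / 2 ^ q.1) (1 / 2 ^ q.1) (by positivity) (p.J q) hJ
      rw [← Cube.toSet_eq_cube, hb] at h
      refine (measureReal_mono (s₂ := {x ∈ q.toSet | p.J q < |f x - ⨍ y in q.toSet, f y|})
        (fun x hx => ⟨hx.1, ?_⟩)
        (ne_top_of_le_ne_top hqt (measure_mono fun x hx => hx.1))).trans (h.trans ?_)
      · have := hx.2
        exact lt_of_lt_of_le (by linarith) (le_abs_self _)
      · have e : -p.J q / (p.C₂ * p.nrm) = -Real.log (p.C₁ * q.meas / p.η) := by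
          rw [Params.J]; field_simp
        rw [e, Real.exp_neg, Real.exp_log (by positivity)]
        change p.C₁ * q.meas * _ ≤ _
        apply le_of_eq
        field_simp
    · push Not at hJ
      have hlog : Real.log (p.C₁ * q.meas / p.η) ≤ 0 := by
        by_contra! hpos
        have : 0 < p.J q := mul_pos (mul_pos hC2 hb0) hpos
        linarith
      have h1 : p.C₁ * q.meas / p.η ≤ 1 := by
        by_contra! hgt
        linarith [Real.log_pos hgt]
      rw [div_le_one hη] at h1
      have h2 : volume.real {x ∈ q.toSet | z < f x} ≤ q.meas := measureReal_mono (fun x hx => hx.1) hqt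
      nlinarith

/-- A level whose superlevel set has measure more than `|𝒬_t| η` is at most the upper estimate
`⟨f⟩_q + J(q)` of some cube of the partition. -/
lemma exists_level_le {p : Params} {a : ℕ → Fin d → ℝ} (hp : p.Valid) (hd : 0 < d) (hf : IsBMO f)
    (hb : bmoNorm f = p.nrm) (hJN : JohnNirenberg f p.C₁ p.C₂) {t : ℕ} {δ z : ℝ}
    (hδ : (p.partition a t).ncard * p.η < δ) (hz : z ∈ levels f δ) :
    ∃ q ∈ p.partition a t, z ≤ (⨍ x in q.toSet, f x) + p.J q := by
  by_contra! hcon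
  have hfin := partition_finite (a := a) hp hd t
  have hsub : {x ∈ unitCube d | z < f x} ⊆
      ⋃ q ∈ hfin.toFinset, {x ∈ q.toSet | z < f x} := by
    intro x hx
    obtain ⟨q, hq, hxq⟩ := exists_mem_partition (a := a) hp hd t hx.1
    exact Set.mem_iUnion₂.2 ⟨q, hfin.mem_toFinset.2 hq, hxq, hx.2⟩
  have hft : ∀ q : Cube d, volume {x ∈ q.toSet | z < f x} ≠ ⊤ := fun q =>
    ne_top_of_le_ne_top q.volume_ne_top
      (measure_mono (t := q.toSet) fun x hx => hx.1)
  have h1 : volume.real {x ∈ unitCube d | z < f x} ≤ ∑ q ∈ hfin.toFinset, p.η := by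
    refine (measureReal_mono hsub ?_).trans ((measureReal_biUnion_finset_le _ _).trans
      (Finset.sum_le_sum fun q hq => measure_superlevel_le hp hf hb hJN
        (hcon q (hfin.mem_toFinset.1 hq))))
    exact ((measure_biUnion_finset_le _ _).trans_lt
      (ENNReal.sum_lt_top.2 fun q _ => (hft q).lt_top)).ne
  rw [Finset.sum_const, nsmul_eq_mul, ← Set.ncard_eq_toFinset_card _ hfin] at h1
  have : volume.real {x ∈ unitCube d | z < f x} = δ := hz
  linarith

end Averages

/-! ### Point scattering: summing the confidence widths. -/

section Scattering

/-- With `κ = e - 1`, the inequality `log x ≥ 1 - 1/x` bounds the increment below by `κ / (1 + κ (n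
+ 1))`. The factor 3 suffices since `1 ≤ κ`, whence `1 + κ (n + 1) ≤ 3 κ n` for `n ≥ 1`. -/
lemma one_div_le_log_increment (n : ℕ) :
    1 / max 1 (n : ℝ) ≤ 3 * (Real.log (1 + (Real.exp 1 - 1) * (n + 1 : ℕ)) -
      Real.log (1 + (Real.exp 1 - 1) * n)) := by
  have hκ : 1 ≤ Real.exp 1 - 1 := by linarith [Real.add_one_le_exp 1]
  set κ := Real.exp 1 - 1
  push_cast
  have hn : (0 : ℝ) ≤ n := n.cast_nonneg
  have h1 : 0 < 1 + κ * n := by positivity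
  have h2 : 0 < 1 + κ * (n + 1) := by positivity
  rw [← Real.log_div h2.ne' h1.ne']
  have h3 := Real.one_sub_inv_le_log_of_pos (div_pos h2 h1)
  have h4 : 1 - ((1 + κ * (n + 1)) / (1 + κ * n))⁻¹ = κ / (1 + κ * (n + 1)) := by
    field_simp; ring
  rw [h4] at h3
  have h5 : 1 / max 1 (n : ℝ) ≤ 3 * (κ / (1 + κ * (n + 1))) := by
    rw [← mul_div_assoc, div_le_div_iff₀ (by positivity) h2]
    rcases Nat.eq_zero_or_pos n with rfl | hn1
    · norm_num; linarith
    · have : (1 : ℝ) ≤ n := by exact_mod_cast hn1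
      rw [max_eq_right this]
      nlinarith
  linarith

/-- Jensen's inequality for the logarithm, obtained by summing the tangent-line bound at the mean
`A`. -/
lemma sum_log_le {ι : Type*} (F : Finset ι) (hF : F.Nonempty) (n : ι → ℕ) {κ : ℝ} (hκ : 0 ≤ κ) :
    ∑ x ∈ F, Real.log (1 + κ * n x) ≤
      F.card * Real.log (1 + κ * ((∑ x ∈ F, n x : ℕ) : ℝ) / F.card) := by
  have hN : (0 : ℝ) < F.card := by exact_mod_cast hF.card_pos
  set A := 1 + κ * ((∑ x ∈ F, n x : ℕ) : ℝ) / F.card with hA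
  have hA0 : 0 < A := by positivity
  have h : ∀ x ∈ F, Real.log (1 + κ * n x) ≤ (1 + κ * n x) / A - 1 + Real.log A := by
    intro x _
    have hx : 0 < 1 + κ * n x := by positivity
    have := Real.log_le_sub_one_of_pos (div_pos hx hA0)
    rw [Real.log_div hx.ne' hA0.ne'] at this
    linarith
  refine (Finset.sum_le_sum h).trans (le_of_eq ?_)
  rw [Finset.sum_add_distrib, Finset.sum_sub_distrib, ← Finset.sum_div, Finset.sum_add_distrib,
    ← Finset.mul_sum]
  simp only [Finset.sum_const, nsmul_eq_mul, mul_one]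
  have : (F.card + κ * ∑ x ∈ F, (n x : ℝ)) / A = F.card := by
    rw [div_eq_iff hA0.ne', hA]
    push_cast
    field_simp
  rw [this]
  ring

/-- The sum of the reciprocal numbers of earlier visits, for a sequence in a finite set. -/
lemma sum_one_div_visits_le {ι : Type*} [DecidableEq ι] (F : Finset ι) (T : ℕ) (hT : 1 ≤ T)
    (c : ℕ → ι) (hc : ∀ t ∈ Finset.Icc 1 T, c t ∈ F) :
    ∑ t ∈ Finset.Icc 1 T, 1 / max 1 ((((Finset.Ico 1 t).filter fun i => c i = c t).card : ℕ) : ℝ) ≤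
      3 * (F.card * Real.log (1 + (Real.exp 1 - 1) * T / F.card)) := by
  have hκ : 0 ≤ Real.exp 1 - 1 := by linarith [Real.add_one_le_exp 1]
  let v : ℕ → ι → ℕ := fun t x => ((Finset.Ico 1 t).filter fun i => c i = x).card
  -- The sum of logarithms is a potential: a round changes only the term of the cell it visits, by
  -- at least a third of the reciprocal visit number.
  have h1 : ∀ T, (∀ t ∈ Finset.Icc 1 T, c t ∈ F) →
      ∑ t ∈ Finset.Icc 1 T, 1 / max 1 (v t (c t) : ℝ) ≤
        3 * ∑ x ∈ F, Real.log (1 + (Real.exp 1 - 1) * v (T + 1) x) := by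
    intro T hc
    induction T with
    | zero => simp [v]
    | succ T ih =>
      rw [Finset.sum_Icc_succ_top (by omega)]
      have h0 := ih fun t ht => hc t (Finset.mem_Icc.2 ⟨(Finset.mem_Icc.1 ht).1,
        (Finset.mem_Icc.1 ht).2.trans (Nat.le_succ _)⟩)
      have hmem := hc (T + 1) (Finset.mem_Icc.2 ⟨by omega, le_rfl⟩)
      have hv : ∀ x, v (T + 1 + 1) x = v (T + 1) x + if c (T + 1) = x then 1 else 0 := by
        intro x
        simp only [v]
        rw [show Finset.Ico 1 (T + 1 + 1) = insert (T + 1) (Finset.Ico 1 (T + 1)) by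
          ext; simp, Finset.filter_insert]
        split_ifs
        · rw [Finset.card_insert_of_notMem (by simp)]
        · rfl
      have h2 : ∑ x ∈ F, Real.log (1 + (Real.exp 1 - 1) * v (T + 1 + 1) x) -
          ∑ x ∈ F, Real.log (1 + (Real.exp 1 - 1) * v (T + 1) x) =
          Real.log (1 + (Real.exp 1 - 1) * (v (T + 1) (c (T + 1)) + 1 : ℕ)) -
            Real.log (1 + (Real.exp 1 - 1) * v (T + 1) (c (T + 1))) := by
        rw [← Finset.sum_sub_distrib, Finset.sum_eq_single_of_mem _ hmem]
        · rw [hv, if_pos rfl]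
        · intro x _ hx
          rw [hv, if_neg (Ne.symm hx), add_zero, sub_self]
      have h3 := one_div_le_log_increment (v (T + 1) (c (T + 1)))
      linarith
  have hF : F.Nonempty := ⟨_, hc 1 (Finset.mem_Icc.2 ⟨le_rfl, hT⟩)⟩
  have hsum : ∑ x ∈ F, v (T + 1) x = T := by
    have := Finset.card_eq_sum_card_fiberwise (f := c) (s := Finset.Ico 1 (T + 1)) (t := F)
      fun t ht => hc t (by
        have := Finset.mem_Ico.1 (Finset.mem_coe.1 ht)
        exact Finset.mem_Icc.2 ⟨this.1, by omega⟩)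
    rw [Nat.card_Ico] at this
    simp only [v]
    omega
  have h2 := sum_log_le F hF (v (T + 1)) hκ
  rw [hsum] at h2
  have := h1 T hc
  change ∑ t ∈ Finset.Icc 1 T, 1 / max 1 (v t (c t) : ℝ) ≤ _
  linarith

variable {d : ℕ} {p : Params} {a : ℕ → Fin d → ℝ}

/-- The horizon-dependent factor `√(T N log (1 + (e - 1) T / N))`. -/
noncomputable def scatter (T N : ℕ) : ℝ :=
  Real.sqrt ((T : ℝ) * N * Real.log (1 + (Real.exp 1 - 1) * (T : ℝ) / N))

/-- Point scattering: the sum of the confidence widths of the selected cubes. -/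
lemma sum_H_le (hp : p.Valid) (hd : 0 < d) (c : ℕ → Cube d)
    (hc : ∀ t ∈ Finset.Icc 1 p.T, c t ∈ p.partition a t)
    (hac : ∀ t ∈ Finset.Icc 1 p.T, a t ∈ (c t).toSet) :
    ∑ t ∈ Finset.Icc 1 p.T, p.H a t (c t) ≤
      2 * ((p.Psi + p.D) * p.conf * scatter p.T (p.partition a p.T).ncard) := by
  classical
  -- `e t` will be the cell of the final partition that contains the arm of round `t`.
  have hex : ∀ t, ∃ q, t ∈ Finset.Icc 1 p.T → q ∈ p.partition a p.T ∧ a t ∈ q.toSet := by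
    intro t
    by_cases ht : t ∈ Finset.Icc 1 p.T
    · obtain ⟨q, h⟩ := exists_mem_partition (a := a) hp hd p.T
        (toSet_subset_unitCube (hc t ht) (hac t ht))
      exact ⟨q, fun _ => h⟩
    · exact ⟨c t, fun h => absurd h ht⟩
  choose e he using hex
  have hfin := partition_finite (a := a) hp hd p.T
  have hvis := sum_one_div_visits_le hfin.toFinset p.T hp.one_le_T e
    fun t ht => hfin.mem_toFinset.2 (he t ht).1
  rw [← Set.ncard_eq_toFinset_card _ hfin] at hvis
  set N := (p.partition a p.T).ncard
  -- The final cell of `a t` lies inside the current cube `c t`, so earlier arms in that final cell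
  -- are hits of `c t`.
  have hcount : ∀ t ∈ Finset.Icc 1 p.T, ((Finset.Ico 1 t).filter fun i => e i = e t).card ≤
      count a t (c t) := by
    intro t ht
    unfold count hits
    refine Finset.card_le_card fun i hi => ?_
    obtain ⟨hi1, hi2⟩ := Finset.mem_filter.1 hi
    refine Finset.mem_filter.2 ⟨hi1, ?_⟩
    have hit : i ∈ Finset.Icc 1 p.T := by
      rw [Finset.mem_Icc] at *; rw [Finset.mem_Ico] at hi1; omega
    exact toSet_subset_of_partition (Finset.mem_Icc.1 ht).2 (hc t ht) (he t ht).1 (hac t ht)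
      (he t ht).2 (hi2 ▸ (he i hit).2)
  have h1 : ∑ t ∈ Finset.Icc 1 p.T, 1 / max 1 (count a t (c t) : ℝ) ≤
      3 * (N * Real.log (1 + (Real.exp 1 - 1) * p.T / N)) := by
    refine (Finset.sum_le_sum fun t ht => ?_).trans hvis
    have := hcount t ht
    gcongr
  -- Cauchy–Schwarz against the constant 1; the resulting `√3` is rounded up to 2.
  have h2 : ∑ t ∈ Finset.Icc 1 p.T, 1 / Real.sqrt (max 1 (count a t (c t) : ℝ)) ≤
      2 * scatter p.T N := by
    have hcs := Finset.sum_mul_sq_le_sq_mul_sq (Finset.Icc 1 p.T) (fun _ => (1 : ℝ))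
      fun t => 1 / Real.sqrt (max 1 (count a t (c t) : ℝ))
    simp only [one_mul, one_pow, Finset.sum_const, nsmul_eq_mul, mul_one, Nat.card_Icc,
      Nat.add_sub_cancel] at hcs
    have e1 : ∀ t, (1 / Real.sqrt (max 1 (count a t (c t) : ℝ))) ^ 2 =
        1 / max 1 (count a t (c t) : ℝ) := fun t => by
      rw [div_pow, one_pow, Real.sq_sqrt (by positivity)]
    simp only [e1] at hcs
    have hX : (0 : ℝ) ≤ p.T * N * Real.log (1 + (Real.exp 1 - 1) * p.T / N) := by
      have : 0 ≤ (Real.exp 1 - 1) * p.T / N := by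
        have : 0 ≤ Real.exp 1 - 1 := by linarith [Real.add_one_le_exp 1]
        positivity
      exact mul_nonneg (by positivity) (Real.log_nonneg (by linarith))
    refine (abs_le_of_sq_le_sq' (b := 2 * scatter p.T N) ?_
      (mul_nonneg zero_le_two (Real.sqrt_nonneg _))).2
    rw [mul_pow, scatter, Real.sq_sqrt hX]
    have : (p.T : ℝ) * ∑ t ∈ Finset.Icc 1 p.T, 1 / max 1 (count a t (c t) : ℝ) ≤
        p.T * (3 * (N * Real.log (1 + (Real.exp 1 - 1) * p.T / N))) := by gcongr
    linarith
  have hk : 0 ≤ (p.Psi + p.D) * p.conf :=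
    mul_nonneg (add_nonneg hp.Psi_nonneg hp.D_nonneg) (Real.sqrt_nonneg _)
  calc ∑ t ∈ Finset.Icc 1 p.T, p.H a t (c t)
      = (p.Psi + p.D) * p.conf *
          ∑ t ∈ Finset.Icc 1 p.T, 1 / Real.sqrt (max 1 (count a t (c t) : ℝ)) := by
        rw [Finset.mul_sum]
        exact Finset.sum_congr rfl fun t _ => by rw [mul_one_div]; rfl
    _ ≤ (p.Psi + p.D) * p.conf * (2 * scatter p.T N) := by gcongr
    _ = _ := by ring

/-- Bernoulli's inequality gives `(1 + (e - 1) T / N)^N ≥ 1 + (e - 1) T ≥ e`. This lets a bare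
multiple of `Ψ` be absorbed into the regret bound. -/
lemma one_le_scatter {T N : ℕ} (hT : 1 ≤ T) (hN : 1 ≤ N) : 1 ≤ scatter T N := by
  have hT' : (1 : ℝ) ≤ T := by exact_mod_cast hT
  have hN' : (1 : ℝ) ≤ N := by exact_mod_cast hN
  have hκ : 1 ≤ Real.exp 1 - 1 := by linarith [Real.add_one_le_exp 1]
  rw [scatter, Real.one_le_sqrt]
  have h0 : 0 < (Real.exp 1 - 1) / N := by positivity
  have h1 : 1 ≤ N * Real.log (1 + (Real.exp 1 - 1) * T / N) := by
    have h2 : Real.log (1 + (Real.exp 1 - 1)) ≤ Real.log ((1 + (Real.exp 1 - 1) * T / N) ^ N) := by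
      refine Real.log_le_log (by positivity) ?_
      have := one_add_mul_le_pow (a := (Real.exp 1 - 1) * T / N)
        (by have : 0 ≤ (Real.exp 1 - 1) * T / N := by positivity
            linarith) N
      refine le_trans ?_ this
      have : (N : ℝ) * ((Real.exp 1 - 1) * T / N) = (Real.exp 1 - 1) * T := by field_simp
      rw [this]
      nlinarith
    rw [Real.log_pow, add_sub_cancel, Real.log_exp] at h2
    exact h2
  rw [mul_assoc]
  nlinarith

end Scattering

/-! ### Exponential moments on a cube. -/

section ExponentialMoments

variable {d : ℕ} {f : (Fin d → ℝ) → ℝ}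

/-- The uniform distribution on a dyadic cube. -/
noncomputable def unif (q : Cube d) : Measure (Fin d → ℝ) :=
  (volume q.toSet)⁻¹ • volume.restrict q.toSet

lemma unif_apply (q : Cube d) {B : Set (Fin d → ℝ)} (hB : MeasurableSet B) :
    unif q B = ENNReal.ofReal (volume.real (B ∩ q.toSet) / q.meas) := by
  have ht : volume (B ∩ q.toSet) ≠ ⊤ :=
    ne_top_of_le_ne_top q.volume_ne_top (measure_mono Set.inter_subset_right)
  rw [unif, Measure.smul_apply, Measure.restrict_apply hB, smul_eq_mul,
    ENNReal.ofReal_div_of_pos q.meas_pos, ← q.volume_eq, measureReal_def, ENNReal.ofReal_toReal ht,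
    mul_comm, ENNReal.div_eq_inv_mul, mul_comm]

instance (q : Cube d) : IsProbabilityMeasure (unif q) := by
  refine ⟨?_⟩
  rw [unif_apply q MeasurableSet.univ, Set.univ_inter]
  change ENNReal.ofReal (q.meas / q.meas) = 1
  rw [div_self q.meas_pos.ne', ENNReal.ofReal_one]

lemma unif_absolutelyContinuous (q : Cube d) : unif q ≪ volume :=
  (Measure.smul_absolutelyContinuous).trans Measure.absolutelyContinuous_restrict

lemma setAverage_eq_integral_unif (q : Cube d) (g : (Fin d → ℝ) → ℝ) :
    ⨍ x in q.toSet, g x = ∫ x, g x ∂(unif q) := by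
  rw [average, unif, Measure.restrict_apply_univ]

lemma integrable_unif (hf : LocallyIntegrable f volume) (q : Cube d) : Integrable f (unif q) :=
  (integrableOn_toSet hf q).smul_measure (by
    rw [ENNReal.inv_ne_top, q.volume_eq]
    exact (ENNReal.ofReal_pos.2 q.meas_pos).ne')

lemma unif_tail_le {C₁ C₂ : ℝ} (hJN : JohnNirenberg f C₁ C₂)
    (hf : Measurable f) (q : Cube d) {r : ℝ} (hr : 0 < r) :
    unif q {x | r < |f x - ⨍ y in q.toSet, f y|} ≤
      ENNReal.ofReal (C₁ * Real.exp (-r / (C₂ * bmoNorm f))) := by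
  have hm := q.meas_pos
  rw [unif_apply q (measurableSet_lt measurable_const (by fun_prop))]
  refine ENNReal.ofReal_le_ofReal ?_
  rw [div_le_iff₀ hm]
  have h := hJN (fun i => (q.2 i : ℝ) / 2 ^ q.1) (1 / 2 ^ q.1) (by positivity) r hr
  rw [← Cube.toSet_eq_cube] at h
  rw [Set.inter_comm]
  refine le_trans h (le_of_eq ?_)
  change C₁ * q.meas * _ = _
  ring

/-- Exponential integrability from the John--Nirenberg estimate. -/
lemma lintegral_exp_abs_le {C₁ C₂ : ℝ} (hC₁ : 1 ≤ C₁) (hC₂ : 0 < C₂) (hb : 0 < bmoNorm f)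
    (hJN : JohnNirenberg f C₁ C₂) (hf : Measurable f) (q : Cube d) :
    ∫⁻ x, ENNReal.ofReal (Real.exp (1 / (2 * C₂ * bmoNorm f) * |f x - ⨍ y in q.toSet, f y|))
      ∂(unif q) ≤ ENNReal.ofReal (1 + C₁) := by
  set θ := 1 / (2 * C₂ * bmoNorm f) with hθ
  have hθ0 : 0 < θ := by positivity
  set g : (Fin d → ℝ) → ℝ := fun x => |f x - ⨍ y in q.toSet, f y| with hg
  have hgm : Measurable g := by fun_prop
  have hint : ∀ y, ∫ t in (0 : ℝ)..y, θ * Real.exp (θ * t) = Real.exp (θ * y) - 1 := by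
    intro y
    have := intervalIntegral.integral_eq_sub_of_hasDerivAt (a := 0) (b := y)
      (f := fun t => Real.exp (θ * t)) (f' := fun t => θ * Real.exp (θ * t))
      (fun t _ => by
        have := ((hasDerivAt_id t).const_mul θ).exp
        simpa [mul_comm] using this)
      ((by fun_prop : Continuous fun t => θ * Real.exp (θ * t)).intervalIntegrable _ _)
    rw [this]; simp
  have hlc := lintegral_comp_eq_lintegral_meas_lt_mul (f := g)
    (g := fun t => θ * Real.exp (θ * t)) (unif q) (ae_of_all _ fun x => abs_nonneg _)
    hgm.aemeasurable
    (fun t _ => (by fun_prop : Continuous fun t => θ * Real.exp (θ * t)).intervalIntegrable _ _)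
    (ae_of_all _ fun t => by positivity)
  simp only [hint] at hlc
  -- Layer-cake formula at half the John–Nirenberg decay rate `2θ`: the integrand is at most `C₁ θ
  -- exp(-θ t)`, with integral `C₁`.
  have h1 : ∫⁻ t in Set.Ioi (0 : ℝ), unif q {a | t < g a} * ENNReal.ofReal (θ * Real.exp (θ * t)) ≤
      ENNReal.ofReal C₁ := by
    calc _ ≤ ∫⁻ t in Set.Ioi (0 : ℝ), ENNReal.ofReal (C₁ * θ * Real.exp (-θ * t)) := by
          refine setLIntegral_mono (by fun_prop) fun t ht => ?_
          refine (mul_le_mul_left (unif_tail_le hJN hf q ht) _).trans ?_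
          rw [← ENNReal.ofReal_mul (by positivity)]
          refine ENNReal.ofReal_le_ofReal (le_of_eq ?_)
          have : -t / (C₂ * bmoNorm f) = -(2 * θ) * t := by rw [hθ]; field_simp
          rw [this, show -θ * t = -(2 * θ) * t + θ * t by ring, Real.exp_add]
          ring
      _ = ENNReal.ofReal (∫ t in Set.Ioi (0 : ℝ), C₁ * θ * Real.exp (-θ * t)) := by
          rw [ofReal_integral_eq_lintegral_ofReal]
          · exact (integrableOn_exp_mul_Ioi (by linarith) 0).const_mul _
          · exact ae_of_all _ fun t => by positivity
      _ = ENNReal.ofReal C₁ := by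
          rw [integral_const_mul, integral_exp_mul_Ioi (by linarith)]
          congr 1
          simp
          field_simp
  have h2 : ∀ x, ENNReal.ofReal (Real.exp (θ * g x)) =
      1 + ENNReal.ofReal (Real.exp (θ * g x) - 1) := by
    intro x
    have : 0 ≤ Real.exp (θ * g x) - 1 := by
      have := Real.one_le_exp (mul_nonneg hθ0.le (abs_nonneg (f x - ⨍ y in q.toSet, f y)))
      simp only [hg]; linarith
    rw [← ENNReal.ofReal_one, ← ENNReal.ofReal_add zero_le_one this, add_sub_cancel]
  calc _ = ∫⁻ x, (1 + ENNReal.ofReal (Real.exp (θ * g x) - 1)) ∂(unif q) := lintegral_congr h2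
    _ = 1 + ∫⁻ t in Set.Ioi (0 : ℝ), unif q {a | t < g a} * ENNReal.ofReal (θ * Real.exp (θ * t)) := by
        rw [lintegral_add_left measurable_const, hlc]; simp
    _ ≤ 1 + ENNReal.ofReal C₁ := by gcongr
    _ = _ := by rw [ENNReal.ofReal_add zero_le_one (by linarith), ENNReal.ofReal_one]

/-- A second-order Taylor bound valid for both signs; for a centred variable the linear term
integrates to zero and only the quadratic one remains. -/
lemma exp_le_one_add_add_sq_mul_exp_abs (x : ℝ) :
    Real.exp x ≤ 1 + x + x ^ 2 * Real.exp |x| := by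
  have h := Complex.norm_exp_sub_sum_le_norm_mul_exp (x : ℂ) 2
  simp only [Finset.sum_range_succ, Finset.sum_range_zero, pow_zero, Nat.factorial, zero_add,
    Nat.cast_one, div_one, pow_one, Complex.norm_real, Real.norm_eq_abs, sq_abs, mul_one] at h
  have e : Complex.exp (x : ℂ) - (1 + (x : ℂ)) = ((Real.exp x - (1 + x) : ℝ) : ℂ) := by push_cast; rfl
  rw [e, Complex.norm_real, Real.norm_eq_abs] at h
  linarith [le_abs_self (Real.exp x - (1 + x))]

/-- The moment generating function of a BMO function on a cube is sub-Gaussian near `0`. -/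
lemma lintegral_exp_mul_le {C₁ C₂ : ℝ} (hC₁ : 1 ≤ C₁) (hC₂ : 0 < C₂) (hb : 0 < bmoNorm f)
    (hJN : JohnNirenberg f C₁ C₂) (hf : Measurable f) (hfl : LocallyIntegrable f volume)
    (q : Cube d) {θ V s : ℝ} (hθ : θ = 1 / (4 * C₂ * bmoNorm f)) (hV : V = 2 / θ ^ 2 * (1 + C₁))
    (hs : |s| ≤ θ) :
    ∫⁻ x, ENNReal.ofReal (Real.exp (s * (f x - ⨍ y in q.toSet, f y))) ∂(unif q) ≤
      ENNReal.ofReal (Real.exp (s ^ 2 * V)) := by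
  have hθ0 : 0 < θ := by rw [hθ]; positivity
  set g : (Fin d → ℝ) → ℝ := fun x => f x - ⨍ y in q.toSet, f y with hg
  have hgi : Integrable g (unif q) := (integrable_unif hfl q).sub (integrable_const _)
  have hg0 : ∫ x, g x ∂(unif q) = 0 := by
    rw [hg, integral_sub (integrable_unif hfl q) (integrable_const _), setAverage_eq_integral_unif]
    simp
  have hE := lintegral_exp_abs_le hC₁ hC₂ hb hJN hf q
  have hθ2 : 1 / (2 * C₂ * bmoNorm f) = 2 * θ := by rw [hθ]; field_simp; norm_num
  rw [hθ2] at hE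
  change ∫⁻ x, ENNReal.ofReal (Real.exp (2 * θ * |g x|)) ∂(unif q) ≤ _ at hE
  have hEi : Integrable (fun x => Real.exp (2 * θ * |g x|)) (unif q) := by
    refine ⟨by fun_prop, ?_⟩
    rw [hasFiniteIntegral_iff_ofReal (ae_of_all _ fun x => (Real.exp_pos _).le)]
    exact hE.trans_lt ENNReal.ofReal_lt_top
  have hE' : ∫ x, Real.exp (2 * θ * |g x|) ∂(unif q) ≤ 1 + C₁ := by
    rw [← ofReal_integral_eq_lintegral_ofReal hEi (ae_of_all _ fun x => (Real.exp_pos _).le),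
      ENNReal.ofReal_le_ofReal_iff (by linarith)] at hE
    exact hE
  -- The available rate `2θ` is split in two: one factor `exp(θ|g|)` dominates `g²`, the other
  -- dominates `exp |s g|`.
  have hpt : ∀ x, Real.exp (s * g x) ≤
      1 + s * g x + s ^ 2 * (2 / θ ^ 2) * Real.exp (2 * θ * |g x|) := by
    intro x
    refine (exp_le_one_add_add_sq_mul_exp_abs (s * g x)).trans ?_
    have h1 : |s * g x| ≤ θ * |g x| := by
      rw [abs_mul]; exact mul_le_mul_of_nonneg_right hs (abs_nonneg _)
    have h2 : (θ * |g x|) ^ 2 ≤ 2 * Real.exp (θ * |g x|) := by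
      have h3 : 0 ≤ θ * |g x| := by positivity
      have := Real.quadratic_le_exp_of_nonneg h3
      linarith
    rw [mul_pow, sq_abs] at h2
    have h3 : g x ^ 2 ≤ 2 / θ ^ 2 * Real.exp (θ * |g x|) := by
      rw [div_mul_eq_mul_div, le_div_iff₀ (by positivity)]; linarith
    have h4 : Real.exp |s * g x| ≤ Real.exp (θ * |g x|) := Real.exp_le_exp.2 h1
    have h5 : (s * g x) ^ 2 * Real.exp |s * g x| ≤
        s ^ 2 * (2 / θ ^ 2) * Real.exp (2 * θ * |g x|) := by
      calc (s * g x) ^ 2 * Real.exp |s * g x|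
          = s ^ 2 * (g x ^ 2 * Real.exp |s * g x|) := by ring
        _ ≤ s ^ 2 * (2 / θ ^ 2 * Real.exp (θ * |g x|) * Real.exp (θ * |g x|)) := by gcongr
        _ = _ := by
            rw [mul_assoc (2 / θ ^ 2), ← Real.exp_add]
            ring_nf
    linarith
  have hlin : Integrable (fun x => 1 + s * g x) (unif q) :=
    (integrable_const _).add (hgi.const_mul _)
  have hdom : Integrable (fun x => 1 + s * g x + s ^ 2 * (2 / θ ^ 2) * Real.exp (2 * θ * |g x|))
      (unif q) := hlin.add (hEi.const_mul _)
  calc _ ≤ ∫⁻ x, ENNReal.ofReal (1 + s * g x + s ^ 2 * (2 / θ ^ 2) * Real.exp (2 * θ * |g x|))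
        ∂(unif q) := lintegral_mono fun x => ENNReal.ofReal_le_ofReal (hpt x)
    _ = ENNReal.ofReal (∫ x, (1 + s * g x + s ^ 2 * (2 / θ ^ 2) * Real.exp (2 * θ * |g x|))
        ∂(unif q)) := (ofReal_integral_eq_lintegral_ofReal hdom
          (ae_of_all _ fun x => (Real.exp_pos _).le.trans (hpt x))).symm
    _ ≤ _ := by
        refine ENNReal.ofReal_le_ofReal ?_
        rw [integral_add hlin (hEi.const_mul _),
          integral_add (integrable_const _) (hgi.const_mul _), integral_const_mul,
          integral_const_mul, hg0]
        simp only [integral_const, probReal_univ, smul_eq_mul, mul_one, mul_zero, add_zero]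
        have h6 : s ^ 2 * (2 / θ ^ 2) * ∫ x, Real.exp (2 * θ * |g x|) ∂(unif q) ≤ s ^ 2 * V := by
          rw [hV, ← mul_assoc]; gcongr
        linarith [Real.add_one_le_exp (s ^ 2 * V)]

end ExponentialMoments

/-! ### Conditional laws of the arms and of the noise. -/

/-- Comparison of integrals against a weight that is measurable for a sub-σ-algebra. -/
lemma lintegral_mul_le_of_forall_setLIntegral_le {Ω : Type*} {m m0 : MeasurableSpace Ω}
    (hm : m ≤ m0) {μ : Measure Ω} {g k W : Ω → ENNReal} (hg : Measurable g) (hk : Measurable k)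
    (h : ∀ E, MeasurableSet[m] E → ∫⁻ ω in E, g ω ∂μ ≤ ∫⁻ ω in E, k ω ∂μ)
    (hW : Measurable[m] W) : ∫⁻ ω, W ω * g ω ∂μ ≤ ∫⁻ ω, W ω * k ω ∂μ := by
  -- An `m`-measurable weight sees `u` only through the measure `E ↦ ∫_E u` on `m`, so it suffices
  -- to compare two trimmed measures.
  have e : ∀ u : Ω → ENNReal, Measurable u →
      ∫⁻ ω, W ω * u ω ∂μ = ∫⁻ ω, W ω ∂((μ.withDensity u).trim hm) := by
    intro u hu
    rw [lintegral_trim hm hW, lintegral_withDensity_eq_lintegral_mul μ hu (hW.mono hm le_rfl)]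
    exact lintegral_congr fun ω => mul_comm _ _
  rw [e g hg, e k hk]
  refine lintegral_mono' (Measure.le_iff.2 fun s hs => ?_) le_rfl
  rw [trim_measurableSet_eq hm hs, trim_measurableSet_eq hm hs, withDensity_apply _ (hm s hs),
    withDensity_apply _ (hm s hs)]
  exact h s hs

section Run

variable {Ω : Type*} {d : ℕ} {Q : ℕ → Ω → Cube d} {A : ℕ → Ω → Fin d → ℝ} {Y : ℕ → Ω → ℝ}

lemma measurable_cube_preArm (t : ℕ) : Measurable[preArm Q A Y t] (Q t) :=
  (comap_measurable (Q t)).mono le_sup_right le_rfl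

lemma measurable_arm_postArm (t : ℕ) : Measurable[postArm Q A Y t] (A t) :=
  (comap_measurable (A t)).mono le_sup_right le_rfl

lemma measurable_past_preArm {i t : ℕ} (hi : i ∈ Finset.Ico 1 t) :
    Measurable[preArm Q A Y t] fun ω => (Q i ω, A i ω, Y i ω) :=
  (comap_measurable _).mono ((le_iSup₂ (f := fun i (_ : i ∈ Finset.Ico 1 t) =>
    MeasurableSpace.comap (fun ω => (Q i ω, A i ω, Y i ω)) inferInstance) i hi).trans
      le_sup_left) le_rfl

variable [mΩ : MeasurableSpace Ω] {P : Measure Ω} {p : Params} {f : (Fin d → ℝ) → ℝ}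

lemma IsRun.preArm_le (h : IsRun P p f Q A Y) (t : ℕ) : preArm Q A Y t ≤ mΩ :=
  sup_le (iSup₂_le fun i _ => ((h.measurable_cube i).prodMk
    ((h.measurable_arm i).prodMk (h.measurable_reward i))).comap_le) (h.measurable_cube t).comap_le

lemma IsRun.postArm_le (h : IsRun P p f Q A Y) (t : ℕ) : postArm Q A Y t ≤ mΩ :=
  sup_le (h.preArm_le t) (h.measurable_arm t).comap_le

lemma IsRun.measurable_unif (h : IsRun P p f Q A Y) (t : ℕ) : Measurable fun ω => unif (Q t ω) :=
  (measurable_of_countable (unif (d := d))).comp (h.measurable_cube t)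

lemma IsRun.ae_cube_mem (h : IsRun P p f Q A Y) {t : ℕ} (ht : t ∈ Finset.Icc 1 p.T) :
    ∀ᵐ ω ∂P, Q t ω ∈ p.partition (fun i => A i ω) t :=
  (h.optimistic t ht).mono fun _ hω => hω.1

variable [IsProbabilityMeasure P]

/-- The conditional law of the arm. -/
lemma IsRun.map_arm_restrict (h : IsRun P p f Q A Y) {t : ℕ} (ht : t ∈ Finset.Icc 1 p.T) {E : Set Ω}
    (hE : MeasurableSet[preArm Q A Y t] E) :
    (P.restrict E).map (A t) = (P.restrict E).bind fun ω => unif (Q t ω) := by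
  have hm := h.preArm_le t
  ext B hB
  rw [Measure.map_apply (h.measurable_arm t) hB,
    Measure.bind_apply hB (h.measurable_unif t).aemeasurable]
  have hAB := h.measurable_arm t hB
  have hmeasq : Measurable fun ω => volume.real (B ∩ (Q t ω).toSet) / (Q t ω).meas :=
    (measurable_of_countable fun q : Cube d => volume.real (B ∩ q.toSet) / q.meas).comp
      (h.measurable_cube t)
  have hle : ∀ q : Cube d, volume.real (B ∩ q.toSet) / q.meas ≤ 1 := fun q =>
    (div_le_one q.meas_pos).2 (measureReal_mono Set.inter_subset_right q.volume_ne_top)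
  have hnn : ∀ q : Cube d, 0 ≤ volume.real (B ∩ q.toSet) / q.meas := fun q =>
    div_nonneg measureReal_nonneg q.meas_pos.le
  have hint : Integrable ((A t ⁻¹' B).indicator fun _ => (1 : ℝ)) P :=
    (integrable_const 1).indicator hAB
  have h1 := setIntegral_condExp hm hint hE
  rw [setIntegral_congr_ae (hm E hE)
    ((h.uniform t ht B hB).mono fun ω hω _ => hω), integral_indicator hAB, setIntegral_const,
    smul_eq_mul, mul_one] at h1
  have h2 : ∀ ω, unif (Q t ω) B =
      ENNReal.ofReal (volume.real (B ∩ (Q t ω).toSet) / (Q t ω).meas) := fun ω => unif_apply _ hB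
  rw [lintegral_congr h2, ← ofReal_integral_eq_lintegral_ofReal _ (ae_of_all _ fun ω => hnn _), h1,
    measureReal_def, ENNReal.ofReal_toReal (measure_ne_top _ _)]
  refine Integrable.of_bound (C := 1) hmeasq.aestronglyMeasurable (ae_of_all _ fun ω => ?_)
  rw [Real.norm_eq_abs, abs_of_nonneg (hnn _)]
  exact hle _

lemma IsRun.setLIntegral_arm (h : IsRun P p f Q A Y) {t : ℕ} (ht : t ∈ Finset.Icc 1 p.T) {E : Set Ω}
    (hE : MeasurableSet[preArm Q A Y t] E) {k : (Fin d → ℝ) → ENNReal} (hk : Measurable k) :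
    ∫⁻ ω in E, k (A t ω) ∂P = ∫⁻ ω in E, ∫⁻ x, k x ∂(unif (Q t ω)) ∂P := by
  rw [← lintegral_map hk (h.measurable_arm t), h.map_arm_restrict ht hE,
    Measure.lintegral_bind (h.measurable_unif t).aemeasurable hk.aemeasurable]

/-- There are countably many cubes, so the selected cube may be fixed; on that event the uniform law
does not charge its complement. -/
lemma IsRun.arm_mem (h : IsRun P p f Q A Y) {t : ℕ} (ht : t ∈ Finset.Icc 1 p.T) :
    ∀ᵐ ω ∂P, A t ω ∈ (Q t ω).toSet := by
  have h1 : ∀ c : Cube d, ∀ᵐ ω ∂P, Q t ω = c → A t ω ∈ c.toSet := by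
    intro c
    have hE : MeasurableSet[preArm Q A Y t] (Q t ⁻¹' {c}) :=
      measurable_cube_preArm t (measurableSet_singleton c)
    have hk : Measurable (c.toSetᶜ.indicator fun _ => (1 : ENNReal)) :=
      measurable_const.indicator (measurableSet_toSet c).compl
    have hkA : Measurable fun ω => c.toSetᶜ.indicator (fun _ => (1 : ENNReal)) (A t ω) :=
      hk.comp (h.measurable_arm t)
    have h2 := h.setLIntegral_arm ht hE hk
    have h3 : ∫⁻ ω in Q t ⁻¹' {c}, ∫⁻ x, c.toSetᶜ.indicator (fun _ => 1) x ∂(unif (Q t ω)) ∂P = 0 := by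
      rw [setLIntegral_congr_fun (g := fun _ => 0) (h.preArm_le t _ hE), lintegral_zero]
      intro ω hω
      simp only
      rw [show Q t ω = c from hω, lintegral_indicator (measurableSet_toSet c).compl]
      simp [unif_apply c (measurableSet_toSet c).compl]
    rw [h3, lintegral_eq_zero_iff hkA,
      Filter.EventuallyEq, ae_restrict_iff' (h.preArm_le t _ hE)] at h2
    filter_upwards [h2] with ω hω hQ
    by_contra hA
    have := hω hQ
    rw [Set.indicator_of_mem (show A t ω ∈ c.toSetᶜ from hA)] at this
    exact one_ne_zero this
  filter_upwards [ae_all_iff.2 h1] with ω hω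
  exact hω _ rfl

/-- Consequently the arms do not see changes of `f` on a null set, and `f` can be replaced by a
measurable version. -/
lemma IsRun.map_arm_absolutelyContinuous (h : IsRun P p f Q A Y) {t : ℕ}
    (ht : t ∈ Finset.Icc 1 p.T) : P.map (A t) ≪ volume := by
  refine Measure.AbsolutelyContinuous.mk fun s hs hs0 => ?_
  have := h.map_arm_restrict ht (E := Set.univ) MeasurableSet.univ
  rw [Measure.restrict_univ] at this
  rw [this, Measure.bind_apply hs (h.measurable_unif t).aemeasurable]
  simp [fun ω => unif_absolutelyContinuous (Q t ω) hs0]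

/-- The selected cube lies in the finite grid, so the sum of the `L¹` norms of `f` over all grid
cubes dominates. -/
lemma IsRun.integrable_reward (h : IsRun P p f Q A Y) (hp : p.Valid) (hd : 0 < d)
    (hfl : LocallyIntegrable f volume) (hf : Measurable f) {t : ℕ} (ht : t ∈ Finset.Icc 1 p.T) :
    Integrable (fun ω => f (A t ω)) P := by
  refine ⟨(hf.comp (h.measurable_arm t)).aestronglyMeasurable, ?_⟩
  have h1 := h.setLIntegral_arm ht (E := Set.univ) MeasurableSet.univ (k := fun x => ‖f x‖ₑ)
    (by fun_prop)
  rw [setLIntegral_univ, setLIntegral_univ] at h1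
  rw [HasFiniteIntegral, h1]
  calc _ ≤ ∫⁻ _, (∑ c ∈ cubesBelow d (p.gridSize d), ∫⁻ x, ‖f x‖ₑ ∂(unif c)) ∂P := by
        refine lintegral_mono_ae ((h.ae_cube_mem ht).mono fun ω hω => ?_)
        exact Finset.single_le_sum (f := fun c => ∫⁻ x, ‖f x‖ₑ ∂(unif c)) (fun _ _ => zero_le)
          (mem_cubesBelow hp hd hω)
    _ < ⊤ := by
        rw [lintegral_const, measure_univ, mul_one]
        exact ENNReal.sum_lt_top.2 fun c _ => (integrable_unif hfl c).2

/-- The conditional mean reward of a round is the mean of `f` over the selected cube. -/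
lemma IsRun.condExp_reward (h : IsRun P p f Q A Y) (hp : p.Valid) (hd : 0 < d)
    (hfl : LocallyIntegrable f volume) (hf : Measurable f) {t : ℕ} (ht : t ∈ Finset.Icc 1 p.T) :
    P[fun ω => f (A t ω) | preArm Q A Y t] =ᵐ[P] fun ω => ⨍ x in (Q t ω).toSet, f x := by
  have hint := h.integrable_reward hp hd hfl hf ht
  have hgm : Measurable[preArm Q A Y t] fun ω => ⨍ x in (Q t ω).toSet, f x :=
    (measurable_of_countable fun q : Cube d => ⨍ x in q.toSet, f x).comp (measurable_cube_preArm t)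
  have hgi : Integrable (fun ω => ⨍ x in (Q t ω).toSet, f x) P := by
    refine Integrable.of_bound (C := ∑ c ∈ cubesBelow d (p.gridSize d), |⨍ x in c.toSet, f x|)
      (hgm.mono (h.preArm_le t) le_rfl).aestronglyMeasurable
      ((h.ae_cube_mem ht).mono fun ω hω => ?_)
    exact Finset.single_le_sum (f := fun c : Cube d => |⨍ x in c.toSet, f x|)
      (fun _ _ => abs_nonneg _) (mem_cubesBelow hp hd hω)
  refine (ae_eq_condExp_of_forall_setIntegral_eq (h.preArm_le t) hint
    (fun _ _ _ => hgi.integrableOn) (fun E hE _ => ?_) hgm.aestronglyMeasurable).symm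
  -- Since `f` takes both signs, the disintegration of the arm is phrased with kernels, whose
  -- integral formula holds for integrable functions.
  let κ : ProbabilityTheory.Kernel Ω (Fin d → ℝ) := ⟨fun ω => unif (Q t ω), h.measurable_unif t⟩
  have hcomp : (ProbabilityTheory.Kernel.comp κ
      (ProbabilityTheory.Kernel.const Unit (P.restrict E))) () = (P.restrict E).map (A t) := by
    rw [ProbabilityTheory.Kernel.comp_apply, ProbabilityTheory.Kernel.const_apply,
      h.map_arm_restrict ht hE]
    rfl
  have hi : Integrable f ((P.restrict E).map (A t)) :=
    (integrable_map_measure hf.aestronglyMeasurable (h.measurable_arm t).aemeasurable).2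
      hint.integrableOn
  rw [← hcomp] at hi
  have h1 := ProbabilityTheory.Kernel.integral_comp hi
  rw [hcomp, integral_map (h.measurable_arm t).aemeasurable hf.aestronglyMeasurable,
    ProbabilityTheory.Kernel.const_apply] at h1
  rw [h1]
  exact integral_congr_ae (ae_of_all _ fun ω => setAverage_eq_integral_unif _ _)

/-- The noise is conditionally sub-Gaussian near `0`. -/
lemma IsRun.setLIntegral_exp_noise_le (h : IsRun P p f Q A Y) (hf : Measurable f) {t : ℕ}
    (ht : t ∈ Finset.Icc 1 p.T) {s : ℝ} (hs : |s| * p.D ≤ 1) {E : Set Ω}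
    (hE : MeasurableSet[postArm Q A Y t] E) :
    ∫⁻ ω in E, ENNReal.ofReal (Real.exp (s * (Y t ω - f (A t ω)))) ∂P ≤
      ∫⁻ _ in E, ENNReal.ofReal (Real.exp (s ^ 2 * p.D ^ 2)) ∂P := by
  have hm := h.postArm_le t
  have hZm : Measurable fun ω => Y t ω - f (A t ω) :=
    (h.measurable_reward t).sub (hf.comp (h.measurable_arm t))
  have hZi : Integrable (fun ω => Y t ω - f (A t ω)) P :=
    Integrable.of_bound (C := p.D) hZm.aestronglyMeasurable (h.noise_bounded t ht)
  have hZ0 : ∫ ω in E, (Y t ω - f (A t ω)) ∂P = 0 := by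
    rw [← setIntegral_condExp hm hZi hE]
    exact (setIntegral_congr_ae (hm E hE) ((h.noise_centered t ht).mono fun ω hω _ => hω)).trans
      (by simp)
  -- `exp x ≤ 1 + x + x²` for `|x| ≤ 1`; this is where `|s| D ≤ 1` enters. The linear term vanishes
  -- because the noise is centred.
  have hbd : ∀ᵐ ω ∂(P.restrict E), Real.exp (s * (Y t ω - f (A t ω))) ≤
      1 + s ^ 2 * p.D ^ 2 + s * (Y t ω - f (A t ω)) := by
    filter_upwards [ae_restrict_of_ae (h.noise_bounded t ht)] with ω hω
    have h1 : |s * (Y t ω - f (A t ω))| ≤ |s| * p.D := by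
      rw [abs_mul]; gcongr
    have h2 := (abs_le.1 (Real.abs_exp_sub_one_sub_id_le (h1.trans hs))).2
    have h3 : (s * (Y t ω - f (A t ω))) ^ 2 ≤ s ^ 2 * p.D ^ 2 := by
      rw [mul_pow]
      exact mul_le_mul_of_nonneg_left (sq_le_sq' (by linarith [(abs_le.1 hω).1])
        (abs_le.1 hω).2) (sq_nonneg s)
    linarith
  have hci : Integrable (fun _ : Ω => 1 + s ^ 2 * p.D ^ 2) (P.restrict E) := integrable_const _
  have hsi : Integrable (fun ω => s * (Y t ω - f (A t ω))) (P.restrict E) :=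
    (hZi.const_mul s).integrableOn
  calc _ ≤ ∫⁻ ω in E, ENNReal.ofReal (1 + s ^ 2 * p.D ^ 2 + s * (Y t ω - f (A t ω))) ∂P :=
        lintegral_mono_ae (hbd.mono fun ω hω => ENNReal.ofReal_le_ofReal hω)
    _ = ENNReal.ofReal (∫ ω in E, (1 + s ^ 2 * p.D ^ 2 + s * (Y t ω - f (A t ω))) ∂P) :=
        (ofReal_integral_eq_lintegral_ofReal (hci.add hsi)
          (hbd.mono fun ω hω => (Real.exp_pos _).le.trans hω)).symm
    _ = ENNReal.ofReal (P.real E * (1 + s ^ 2 * p.D ^ 2)) := by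
        rw [integral_add hci hsi, integral_const_mul, hZ0, setIntegral_const]
        simp
    _ ≤ ENNReal.ofReal (P.real E * Real.exp (s ^ 2 * p.D ^ 2)) := by
        refine ENNReal.ofReal_le_ofReal (mul_le_mul_of_nonneg_left ?_ measureReal_nonneg)
        linarith [Real.add_one_le_exp (s ^ 2 * p.D ^ 2)]
    _ = _ := by
        rw [setLIntegral_const, mul_comm, ENNReal.ofReal_mul (Real.exp_pos _).le, measureReal_def,
          ENNReal.ofReal_toReal (measure_ne_top _ _)]

end Run

/-! ### The exponential supermartingale of a fixed cube. -/

/-- Variance proxy of the centred rewards in a cube. -/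
noncomputable def varProxy (C₁ C₂ b D : ℝ) : ℝ := 2 / (1 / (4 * C₂ * b)) ^ 2 * (1 + C₁) + D ^ 2

/-- A range in which the sub-Gaussian bound for the centred rewards is valid. -/
noncomputable def expScale (C₂ b D : ℝ) : ℝ := min (1 / (4 * C₂ * b)) (1 / (D + 1))

section Supermartingale

variable {Ω : Type*} {d : ℕ}

open Classical in
/-- The rounds before `t` whose arm lies in `q`, a subset of the cube selected in that round. -/
noncomputable def nestedHits (a : ℕ → Fin d → ℝ) (c : ℕ → Cube d) (t : ℕ) (q : Cube d) : Finset ℕ :=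
  (Finset.Ico 1 t).filter fun i => a i ∈ q.toSet ∧ q.toSet ⊆ (c i).toSet

open Classical in
/-- The factor that one round contributes to the exponential supermartingale of the cube `q`. -/
noncomputable def factor (q : Cube d) (m s v : ℝ) (w : Cube d × (Fin d → ℝ) × ℝ) : ENNReal :=
  if w.2.1 ∈ q.toSet ∧ q.toSet ⊆ w.1.toSet then ENNReal.ofReal (Real.exp (s * (w.2.2 - m) - v))
  else 1

lemma measurable_factor (q : Cube d) (m s v : ℝ) : Measurable (factor q m s v) := by
  classical
  unfold factor
  refine Measurable.ite ?_ (by fun_prop) measurable_const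
  exact ((measurableSet_toSet q).preimage (measurable_fst.comp measurable_snd)).inter
    ((MeasurableSet.of_discrete (s := {c : Cube d | q.toSet ⊆ c.toSet})).preimage measurable_fst)

/-- A uniform point of `c` that lands in `q` is uniform on `q`, whichever `c ⊇ q` was selected. This
makes a fixed-cube analysis possible although the selected cubes vary. -/
lemma unif_restrict {q c : Cube d} (h : q.toSet ⊆ c.toSet) :
    (unif c).restrict q.toSet = unif c q.toSet • unif q := by
  have hq0 : volume q.toSet ≠ 0 := by
    rw [q.volume_eq]; exact (ENNReal.ofReal_pos.2 q.meas_pos).ne'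
  have e : unif c q.toSet = (volume c.toSet)⁻¹ * volume q.toSet := by
    rw [unif, Measure.smul_apply, smul_eq_mul, Measure.restrict_apply (measurableSet_toSet q),
      Set.inter_eq_left.2 h]
  rw [e, unif, unif, Measure.restrict_smul, Measure.restrict_restrict (measurableSet_toSet q),
    Set.inter_eq_left.2 h, smul_smul, mul_assoc, ENNReal.mul_inv_cancel hq0 q.volume_ne_top, mul_one]

variable [mΩ : MeasurableSpace Ω] {P : Measure Ω} [IsProbabilityMeasure P]
  {p : Params} {f : (Fin d → ℝ) → ℝ} {Q : ℕ → Ω → Cube d} {A : ℕ → Ω → Fin d → ℝ}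
  {Y : ℕ → Ω → ℝ}

/-- The supermartingale step. The noise is averaged first, given the arm, for a factor `exp(s² D²)`.
Then the arm is averaged: whether `q ⊆ Q_t` is known beforehand, and on landing in `q` the arm is
uniform there, for a factor `exp(s² V)`. The normalisation in `factor` cancels both, and rounds that
miss `q` contribute 1. -/
lemma IsRun.lintegral_mul_factor_le (h : IsRun P p f Q A Y) (hf : Measurable f) (q : Cube d)
    {s V : ℝ} (hV : ∫⁻ x, ENNReal.ofReal (Real.exp (s * (f x - ⨍ y in q.toSet, f y))) ∂(unif q) ≤
      ENNReal.ofReal (Real.exp (s ^ 2 * V))) (hs : |s| * p.D ≤ 1) {t : ℕ}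
    (ht : t ∈ Finset.Icc 1 p.T) {W : Ω → ENNReal} (hW : Measurable[preArm Q A Y t] W) :
    ∫⁻ ω, W ω * factor q (⨍ y in q.toSet, f y) s (s ^ 2 * (V + p.D ^ 2)) (Q t ω, A t ω, Y t ω) ∂P ≤
      ∫⁻ ω, W ω ∂P := by
  classical
  set m := ⨍ y in q.toSet, f y
  set v := s ^ 2 * (V + p.D ^ 2)
  have hpre := h.preArm_le t
  have hpost := h.postArm_le t
  have hpp : preArm Q A Y t ≤ postArm Q A Y t := le_sup_left
  let K : Set Ω := {ω | q.toSet ⊆ (Q t ω).toSet}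
  have hK : MeasurableSet[preArm Q A Y t] K :=
    measurable_cube_preArm t (MeasurableSet.of_discrete (s := {c : Cube d | q.toSet ⊆ c.toSet}))
  let H : Set Ω := A t ⁻¹' q.toSet ∩ K
  have hH : MeasurableSet[postArm Q A Y t] H :=
    (measurable_arm_postArm t (measurableSet_toSet q)).inter (hpp _ hK)
  let φ : (Fin d → ℝ) → ENNReal := fun x => ENNReal.ofReal (Real.exp (s * (f x - m) - s ^ 2 * V))
  have hφ : Measurable φ := by fun_prop
  have hWm : Measurable W := hW.mono hpre le_rfl
  have hWc : Measurable fun ω => W ω * Hᶜ.indicator 1 ω :=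
    hWm.mul (measurable_one.indicator (hpost _ hH).compl)
  have hfac : ∀ ω, W ω * factor q m s v (Q t ω, A t ω, Y t ω) = W ω * Hᶜ.indicator 1 ω +
      (W ω * H.indicator (fun ω => φ (A t ω) * ENNReal.ofReal (Real.exp (-(s ^ 2 * p.D ^ 2)))) ω) *
        ENNReal.ofReal (Real.exp (s * (Y t ω - f (A t ω)))) := by
    intro ω
    by_cases hω : ω ∈ H
    · rw [factor, if_pos ⟨hω.1, hω.2⟩, Set.indicator_of_mem hω,
        Set.indicator_of_notMem (show ω ∉ Hᶜ from fun hc => hc hω), mul_zero, zero_add, mul_assoc (W ω),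
        ← ENNReal.ofReal_mul (Real.exp_pos _).le, ← Real.exp_add,
        ← ENNReal.ofReal_mul (Real.exp_pos _).le, ← Real.exp_add]
      congr 3
      simp only [v]
      ring
    · rw [factor, if_neg (fun hc => hω ⟨hc.1, hc.2⟩), Set.indicator_of_notMem hω,
        Set.indicator_of_mem (show ω ∈ Hᶜ from hω)]
      simp
  have hnoise := lintegral_mul_le_of_forall_setLIntegral_le hpost (μ := P)
    (g := fun ω => ENNReal.ofReal (Real.exp (s * (Y t ω - f (A t ω)))))
    (k := fun _ => ENNReal.ofReal (Real.exp (s ^ 2 * p.D ^ 2)))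
    (W := fun ω => W ω * H.indicator (fun ω => φ (A t ω) *
      ENNReal.ofReal (Real.exp (-(s ^ 2 * p.D ^ 2)))) ω)
    ((((h.measurable_reward t).sub (hf.comp (h.measurable_arm t))).const_mul s).exp.ennreal_ofReal)
    measurable_const (fun E hE => h.setLIntegral_exp_noise_le hf ht hs hE)
    ((hW.mono hpp le_rfl).mul (((hφ.comp (measurable_arm_postArm t)).mul_const _).indicator hH))
  have hkA : ∀ k : (Fin d → ℝ) → ENNReal, Measurable k →
      Measurable (H.indicator fun ω => k (A t ω)) := fun k hk =>
    (hk.comp (h.measurable_arm t)).indicator (hpost _ hH)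
  have hset : ∀ E, MeasurableSet[preArm Q A Y t] E → ∀ k : (Fin d → ℝ) → ENNReal, Measurable k →
      ∫⁻ ω in E, H.indicator (fun ω => k (A t ω)) ω ∂P =
        ∫⁻ ω in E ∩ K, ∫⁻ x in q.toSet, k x ∂(unif (Q t ω)) ∂P := by
    intro E hE k hk
    have e : H.indicator (fun ω => k (A t ω)) =
        K.indicator fun ω => q.toSet.indicator k (A t ω) := by
      ext ω
      by_cases h1 : ω ∈ K <;> by_cases h2 : A t ω ∈ q.toSet <;>
        simp [H, h1, h2, Set.indicator]
    rw [e, lintegral_indicator (hpre _ hK), Measure.restrict_restrict (hpre _ hK), Set.inter_comm,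
      h.setLIntegral_arm ht (hE.inter hK) (hk.indicator (measurableSet_toSet q))]
    exact lintegral_congr fun ω => lintegral_indicator (measurableSet_toSet q) _
  have hφ1 : ∫⁻ x, φ x ∂(unif q) ≤ 1 := by
    have e : ∀ x, φ x = ENNReal.ofReal (Real.exp (s * (f x - m))) *
        ENNReal.ofReal (Real.exp (-(s ^ 2 * V))) := fun x => by
      rw [← ENNReal.ofReal_mul (Real.exp_pos _).le, ← Real.exp_add, ← sub_eq_add_neg]
    rw [lintegral_congr e, lintegral_mul_const _ (by fun_prop)]
    refine (mul_le_mul_left hV _).trans ?_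
    rw [← ENNReal.ofReal_mul (Real.exp_pos _).le, ← Real.exp_add, add_neg_cancel, Real.exp_zero,
      ENNReal.ofReal_one]
  have hmain := lintegral_mul_le_of_forall_setLIntegral_le hpre (μ := P)
    (g := H.indicator fun ω => φ (A t ω)) (k := H.indicator fun ω => 1)
    (hkA φ hφ) (hkA (fun _ => 1) measurable_const)
    (fun E hE => by
      rw [hset E hE φ hφ, hset E hE (fun _ => 1) measurable_const]
      refine setLIntegral_mono' (hpre _ (hE.inter hK)) fun ω hω => ?_
      rw [unif_restrict hω.2, lintegral_smul_measure, lintegral_smul_measure]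
      have : ∫⁻ _ : Fin d → ℝ, (1 : ENNReal) ∂(unif q) = 1 := by simp
      rw [this]
      exact mul_le_mul_right hφ1 _) hW
  calc _ = ∫⁻ ω, W ω * Hᶜ.indicator 1 ω ∂P + ∫⁻ ω, (W ω * H.indicator (fun ω => φ (A t ω) *
          ENNReal.ofReal (Real.exp (-(s ^ 2 * p.D ^ 2)))) ω) *
            ENNReal.ofReal (Real.exp (s * (Y t ω - f (A t ω)))) ∂P := by
        rw [lintegral_congr hfac, lintegral_add_left hWc]
    _ ≤ ∫⁻ ω, W ω * Hᶜ.indicator 1 ω ∂P + ∫⁻ ω, W ω * H.indicator (fun ω => φ (A t ω)) ω ∂P := by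
        refine add_le_add le_rfl ?_
        refine hnoise.trans (le_of_eq (lintegral_congr fun ω => ?_))
        by_cases hω : ω ∈ H
        · rw [Set.indicator_of_mem hω, Set.indicator_of_mem hω, mul_assoc, mul_assoc,
            ← ENNReal.ofReal_mul (Real.exp_pos _).le, ← Real.exp_add, neg_add_cancel, Real.exp_zero,
            ENNReal.ofReal_one, mul_one]
        · simp [Set.indicator_of_notMem hω]
    _ ≤ ∫⁻ ω, W ω * Hᶜ.indicator 1 ω ∂P + ∫⁻ ω, W ω * H.indicator (fun _ => 1) ω ∂P := by
        exact add_le_add le_rfl hmain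
    _ = ∫⁻ ω, W ω ∂P := by
        rw [← lintegral_add_left hWc]
        refine lintegral_congr fun ω => ?_
        by_cases hω : ω ∈ H
        · simp [hω]
        · simp [hω]

lemma IsRun.lintegral_prod_factor_le (h : IsRun P p f Q A Y) (hf : Measurable f) (q : Cube d)
    {s V : ℝ} (hV : ∫⁻ x, ENNReal.ofReal (Real.exp (s * (f x - ⨍ y in q.toSet, f y))) ∂(unif q) ≤
      ENNReal.ofReal (Real.exp (s ^ 2 * V))) (hs : |s| * p.D ≤ 1) (t : ℕ) (ht : t ≤ p.T) :
    ∫⁻ ω, ∏ i ∈ Finset.Ico 1 (t + 1), factor q (⨍ y in q.toSet, f y) s (s ^ 2 * (V + p.D ^ 2))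
      (Q i ω, A i ω, Y i ω) ∂P ≤ 1 := by
  induction t with
  | zero => simp
  | succ t ih =>
    refine le_trans (le_of_eq ?_) ((h.lintegral_mul_factor_le hf q hV hs (t := t + 1)
      (Finset.mem_Icc.2 ⟨by omega, ht⟩) (W := fun ω => ∏ i ∈ Finset.Ico 1 (t + 1),
        factor q (⨍ y in q.toSet, f y) s (s ^ 2 * (V + p.D ^ 2)) (Q i ω, A i ω, Y i ω)) ?_).trans
          (ih (by omega)))
    · refine lintegral_congr fun ω => ?_
      rw [Finset.prod_Ico_succ_top (by omega)]
    · exact Finset.measurable_fun_prod _ fun i hi =>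
        (measurable_factor _ _ _ _).comp (measurable_past_preArm hi)

/-- Exponential tail bound for the centred rewards of a cube with a given number of visits. -/
lemma IsRun.measure_tail_le (h : IsRun P p f Q A Y) (hf : Measurable f) (q : Cube d)
    {s V : ℝ} (hV : ∫⁻ x, ENNReal.ofReal (Real.exp (s * (f x - ⨍ y in q.toSet, f y))) ∂(unif q) ≤
      ENNReal.ofReal (Real.exp (s ^ 2 * V))) (hs : |s| * p.D ≤ 1) {t : ℕ}
    (ht : t ∈ Finset.Icc 1 p.T) (n : ℕ) (y : ℝ) :
    P {ω | (nestedHits (fun i => A i ω) (fun i => Q i ω) t q).card = n ∧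
        y ≤ s * ∑ i ∈ nestedHits (fun i => A i ω) (fun i => Q i ω) t q,
          (Y i ω - ⨍ y in q.toSet, f y)} ≤
      ENNReal.ofReal (Real.exp (n * (s ^ 2 * (V + p.D ^ 2)) - y)) := by
  classical
  set m := ⨍ y in q.toSet, f y
  set v := s ^ 2 * (V + p.D ^ 2)
  obtain ⟨t, rfl⟩ := Nat.exists_eq_add_of_le' (Finset.mem_Icc.1 ht).1
  have hint := h.lintegral_prod_factor_le hf q hV hs t (by have := (Finset.mem_Icc.1 ht).2; omega)
  set M : Ω → ENNReal := fun ω => ∏ i ∈ Finset.Ico 1 (t + 1), factor q m s v (Q i ω, A i ω, Y i ω)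
  have hM : Measurable M := Finset.measurable_fun_prod _ fun i _ => (measurable_factor _ _ _ _).comp
    ((h.measurable_cube i).prodMk ((h.measurable_arm i).prodMk (h.measurable_reward i)))
  -- Fixing the number `n` of hits makes the compensator the constant `n v`, so Markov's inequality
  -- for `M` is the tail bound.
  have hMe : ∀ ω, M ω = ENNReal.ofReal (Real.exp
      (s * ∑ i ∈ nestedHits (fun i => A i ω) (fun i => Q i ω) (t + 1) q, (Y i ω - m) -
        (nestedHits (fun i => A i ω) (fun i => Q i ω) (t + 1) q).card * v)) := by
    intro ω
    simp only [M, factor]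
    rw [← Finset.prod_filter, ← ENNReal.ofReal_prod_of_nonneg (fun _ _ => (Real.exp_pos _).le),
      ← Real.exp_sum, Finset.sum_sub_distrib, ← Finset.mul_sum, Finset.sum_const, nsmul_eq_mul]
    rfl
  have hpos : 0 < Real.exp (y - n * v) := Real.exp_pos _
  calc _ ≤ P {ω | ENNReal.ofReal (Real.exp (y - n * v)) ≤ M ω} := by
        refine measure_mono fun ω hω => ?_
        simp only [Set.mem_ofPred_eq] at hω ⊢
        rw [hMe, hω.1]
        exact ENNReal.ofReal_le_ofReal (Real.exp_le_exp.2 (by linarith [hω.2]))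
    _ ≤ (∫⁻ ω, M ω ∂P) / ENNReal.ofReal (Real.exp (y - n * v)) :=
        meas_ge_le_lintegral_div hM.aemeasurable (ENNReal.ofReal_pos.2 hpos).ne'
          ENNReal.ofReal_ne_top
    _ ≤ 1 / ENNReal.ofReal (Real.exp (y - n * v)) := by gcongr
    _ = _ := by
        rw [← ENNReal.ofReal_one, ← ENNReal.ofReal_div_of_pos hpos, one_div, ← Real.exp_neg]
        congr 2
        ring

end Supermartingale

/-! ### Constants and the numerics of the union bound. -/

/-- Growth factor of the averages over the cubes of a partition, relative to `Ψ`. -/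
noncomputable def growth (d : ℕ) (C₁ : ℝ) : ℝ := 2 ^ d * (1 + d + Real.logb 2 C₁) / 2

/-- Value of `√(2 log (2 T² / ε))` from which on the confidence widths are valid. -/
noncomputable def threshold (d : ℕ) (C₁ C₂ b D : ℝ) : ℝ :=
  2 + (d + 1) / (expScale C₂ b D * b) + 8 / (expScale C₂ b D * (C₂ * b)) +
    2 * ((d + 1) * Real.log (2 ^ (d + 1) * C₁) + expScale C₂ b D ^ 2 * varProxy C₁ C₂ b D) +
    growth d C₁

section Numerics

variable {p : Params}

lemma growth_nonneg (d : ℕ) {C₁ : ℝ} (h : 1 ≤ C₁) : 0 ≤ growth d C₁ := by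
  have := Real.logb_nonneg (b := 2) (by norm_num) h
  unfold growth
  positivity

lemma varProxy_nonneg {C₁ : ℝ} (C₂ b D : ℝ) (h : 1 ≤ C₁) : 0 ≤ varProxy C₁ C₂ b D := by
  unfold varProxy; positivity

lemma Params.Valid.expScale_pos (hp : p.Valid) (hb : 0 < p.nrm) : 0 < expScale p.C₂ p.nrm p.D := by
  have := hp.C₂_pos
  have := hp.D_nonneg
  unfold expScale
  positivity

lemma Params.Valid.conf_sq (hp : p.Valid) :
    p.conf ^ 2 = 2 * (Real.log 2 + 2 * Real.log p.T + Real.log (1 / p.ε)) := by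
  have hT := hp.one_le_T_real
  have hε := hp.ε_pos
  have e : Real.log (2 * (p.T : ℝ) ^ 2 / p.ε) =
      Real.log 2 + 2 * Real.log p.T + Real.log (1 / p.ε) := by
    rw [Real.log_div (by positivity) hε.ne', Real.log_mul two_ne_zero (by positivity), Real.log_pow,
      one_div, Real.log_inv]
    push_cast; ring
  have hεl : 0 ≤ Real.log (1 / p.ε) :=
    Real.log_nonneg (by rw [le_div_iff₀ hε]; linarith [hp.ε_lt_one])
  have := Real.log_nonneg hT
  have := Real.log_nonneg (x := 2) (by norm_num)
  rw [Params.conf, Real.sq_sqrt, e]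
  rw [e]; positivity

lemma Params.Valid.one_le_conf (hp : p.Valid) : 1 ≤ p.conf := by
  have h := hp.conf_sq
  have h1 := Real.log_nonneg hp.one_le_T_real
  have h2 : 0 ≤ Real.log (1 / p.ε) :=
    Real.log_nonneg (by rw [le_div_iff₀ hp.ε_pos]; linarith [hp.ε_lt_one])
  have h3 := Real.log_two_gt_d9
  have h4 : 0 ≤ p.conf := Real.sqrt_nonneg _
  nlinarith

/-- A confidence factor below a constant forces a horizon below a constant, where a crude regret
bound is enough. -/
lemma Params.Valid.horizon_le (hp : p.Valid) : (p.T : ℝ) ≤ Real.exp (p.conf ^ 2 / 2) := by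
  have h := hp.conf_sq
  have hT := hp.one_le_T_real
  have h1 := Real.log_nonneg hT
  have h2 : 0 ≤ Real.log (1 / p.ε) :=
    Real.log_nonneg (by rw [le_div_iff₀ hp.ε_pos]; linarith [hp.ε_lt_one])
  have h3 := Real.log_two_gt_d9
  rw [← Real.log_le_iff_le_exp (by linarith)]
  linarith

lemma Params.logb_inv_η_le (p : Params) : 2 * p.nrm * Real.logb 2 (1 / p.η) ≤ p.Psi :=
  le_max_right _ _

lemma Params.Valid.log_inv_η_nonneg (hp : p.Valid) : 0 ≤ Real.log (1 / p.η) :=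
  Real.log_nonneg (by rw [le_div_iff₀ hp.η_pos]; linarith [hp.η_lt_one])

lemma Params.Valid.log_le_logb (hp : p.Valid) :
    Real.log (1 / p.η) ≤ Real.logb 2 (1 / p.η) := by
  have h2 := Real.log_two_lt_d9
  have h3 := Real.log_two_gt_d9
  rw [Real.logb, le_div_iff₀ (by linarith)]
  exact mul_le_of_le_one_right hp.log_inv_η_nonneg (by linarith)

/-- The union bound succeeds once the confidence factor is large. -/
lemma Params.Valid.union_bound (hp : p.Valid) (hb : 0 < p.nrm) (d : ℕ)
    (hS : threshold d p.C₁ p.C₂ p.nrm p.D ≤ p.conf) :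
    (p.gridSize d : ℝ) ^ (d + 1) * p.T * 2 * p.T *
      Real.exp (expScale p.C₂ p.nrm p.D ^ 2 * varProxy p.C₁ p.C₂ p.nrm p.D -
        expScale p.C₂ p.nrm p.D * (p.Psi + p.D) * p.conf) ≤ 2 * p.ε := by
  have hT := hp.one_le_T_real
  have hC := hp.one_le_C₁
  have hC2 := hp.C₂_pos
  have hη := hp.η_pos
  have hε := hp.ε_pos
  have hD := hp.D_nonneg
  set κ := expScale p.C₂ p.nrm p.D with hκ
  have hκ0 : 0 < κ := hp.expScale_pos hb
  set V := varProxy p.C₁ p.C₂ p.nrm p.D with hVdef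
  have hV0 : 0 ≤ V := varProxy_nonneg _ _ _ hC
  set S := p.conf with hSdef
  set L := Real.log (1 / p.η) with hL
  have hL0 : 0 ≤ L := hp.log_inv_η_nonneg
  set c := Real.log (2 ^ (d + 1) * p.C₁) with hc
  have hc0 : 0 ≤ c := Real.log_nonneg (one_le_mul_of_one_le_of_one_le (one_le_pow₀ (by norm_num)) hC)
  have hg := growth_nonneg d hC
  have ha1 : 0 ≤ ((d : ℝ) + 1) / (κ * p.nrm) := by positivity
  have ha2 : 0 ≤ 8 / (κ * (p.C₂ * p.nrm)) := by positivity
  have ha3 : 0 ≤ ((d : ℝ) + 1) * c + κ ^ 2 * V := by positivity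
  unfold threshold at hS
  rw [← hκ, ← hVdef, ← hc] at hS
  -- `threshold` is a sum of nonnegative terms, so each summand separately is a lower bound for `S`.
  have hS2 : 2 ≤ S := by linarith
  have hb1 : (d : ℝ) + 1 ≤ S * (κ * p.nrm) := by
    rw [← div_le_iff₀ (by positivity)]; linarith
  have hb2 : 8 ≤ S * (κ * (p.C₂ * p.nrm)) := by
    rw [← div_le_iff₀ (by positivity)]; linarith
  have hb3 : 2 * (((d : ℝ) + 1) * c + κ ^ 2 * V) ≤ S := by linarith
  -- the grid size
  have hR0 : 1 ≤ 2 ^ d * p.C₁ / p.η := by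
    rw [le_div_iff₀ hη, one_mul]
    have : (1 : ℝ) ≤ 2 ^ d * p.C₁ :=
      one_le_mul_of_one_le_of_one_le (one_le_pow₀ (by norm_num)) hC
    linarith [hp.η_lt_one]
  have hR : (p.gridSize d : ℝ) ≤ Real.exp (c + L) := by
    rw [Real.exp_add, hc, hL, Real.exp_log (by positivity), Real.exp_log (by positivity)]
    have := (Nat.ceil_lt_add_one (by linarith : (0 : ℝ) ≤ 2 ^ d * p.C₁ / p.η)).le
    have e : (2 : ℝ) ^ (d + 1) * p.C₁ * (1 / p.η) = 2 * (2 ^ d * p.C₁ / p.η) := by ring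
    rw [e]
    unfold Params.gridSize
    linarith
  -- the size of `Ψ`
  have hPsi1 : 2 * p.nrm * L ≤ p.Psi :=
    (mul_le_mul_of_nonneg_left hp.log_le_logb (by positivity)).trans p.logb_inv_η_le
  have hconf := hp.conf_sq
  have hPsi2 : p.C₂ * p.nrm * (S ^ 2 / 4) ≤ p.Psi := by
    refine le_trans (mul_le_mul_of_nonneg_left ?_ (by positivity)) (le_max_left _ _)
    have e : Real.log (p.C₁ * (p.T : ℝ) ^ 2 / p.ε) =
        Real.log p.C₁ + 2 * Real.log p.T + Real.log (1 / p.ε) := by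
      rw [Real.log_div (by positivity) hε.ne', Real.log_mul (by positivity) (by positivity),
        Real.log_pow, one_div, Real.log_inv]
      push_cast; ring
    rw [e]
    have := Real.log_nonneg hC
    have := Real.log_two_lt_d9
    nlinarith
  -- The average of the two lower bounds for `Ψ`, times `κ S`, is used. Its first part pays `(d + 1)
  -- L` for the grid; its second is at least `S²`, half of it for `T²/ε` and half for the constants.
  have hmain : ((d : ℝ) + 1) * (c + L) + S ^ 2 / 2 + κ ^ 2 * V ≤ κ * (p.Psi + p.D) * S := by
    have e1 : ((d : ℝ) + 1) * L ≤ S * (κ * p.nrm) * L := mul_le_mul_of_nonneg_right hb1 hL0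
    have e2 : 8 * (S ^ 2 / 8) ≤ S * (κ * (p.C₂ * p.nrm)) * (S ^ 2 / 8) :=
      mul_le_mul_of_nonneg_right hb2 (by positivity)
    have e3 : κ * S * ((p.nrm * L) + p.C₂ * p.nrm * (S ^ 2 / 8)) ≤ κ * S * (p.Psi + p.D) :=
      mul_le_mul_of_nonneg_left (by linarith) (by positivity)
    have e4 : S ≤ S ^ 2 := by nlinarith
    nlinarith
  have hTe : (p.T : ℝ) * p.T = Real.exp (2 * Real.log p.T) := by
    rw [two_mul, Real.exp_add, Real.exp_log (by linarith)]
  have hlog2 : 0 ≤ Real.log 2 := Real.log_nonneg (by norm_num)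
  calc _ = 2 * ((p.gridSize d : ℝ) ^ (d + 1) * (p.T * p.T) *
        Real.exp (κ ^ 2 * V - κ * (p.Psi + p.D) * S)) := by ring
    _ ≤ 2 * (Real.exp (c + L) ^ (d + 1) * Real.exp (2 * Real.log p.T) *
        Real.exp (κ ^ 2 * V - κ * (p.Psi + p.D) * S)) := by
        rw [hTe]; gcongr
    _ = 2 * Real.exp ((d + 1) * (c + L) + 2 * Real.log p.T +
          (κ ^ 2 * V - κ * (p.Psi + p.D) * S)) := by
        rw [← Real.exp_nat_mul, ← Real.exp_add, ← Real.exp_add]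
        push_cast; rfl
    _ ≤ 2 * Real.exp (-Real.log (1 / p.ε)) := by
        gcongr
        linarith
    _ = 2 * p.ε := by rw [one_div, Real.log_inv, neg_neg, Real.exp_log hε]

end Numerics

/-! ### Regret on a fixed trajectory. -/

section Deterministic

variable {d : ℕ} {p : Params} {f : (Fin d → ℝ) → ℝ} {a : ℕ → Fin d → ℝ} {y : ℕ → ℝ}

/-- Cells have generation at most `d + log₂ C₁ + log₂ (1/η)`, and each halving moves the mean by at
most `2^d ‖f‖`. The condition `η < 1/2` makes `log₂ (1/η) ≥ 1`, which absorbs the additive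
constants. -/
lemma abs_setAverage_le_growth (hp : p.Valid) (hd : 0 < d) (hf : IsBMO f) (hb : bmoNorm f = p.nrm)
    (h0 : ⨍ x in unitCube d, f x = 0) (hη : p.η < 1 / 2) {t : ℕ} {q : Cube d}
    (hq : q ∈ p.partition a t) : |⨍ x in q.toSet, f x| ≤ growth d p.C₁ * p.Psi := by
  have h1 := abs_setAverage_le_generation hf h0 (toSet_subset_unitCube hq)
  have hC := hp.one_le_C₁
  have hη0 := hp.η_pos
  have hn := hp.nrm_nonneg
  set l := Real.logb 2 (1 / p.η) with hl
  have hl1 : 1 ≤ l := by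
    rw [hl, Real.le_logb_iff_rpow_le (by norm_num) (by positivity), Real.rpow_one,
      le_div_iff₀ hη0]
    linarith
  have hlC := Real.logb_nonneg (b := 2) (by norm_num) hC
  have hk : (q.1 : ℝ) ≤ d + Real.logb 2 p.C₁ + l := by
    have h2 := generation_bound hp hq
    rw [← lt_div_iff₀ hη0] at h2
    have h3 := Real.logb_le_logb_of_le (b := 2) (by norm_num) (by positivity) h2.le
    rw [div_eq_mul_one_div, Real.logb_mul (by positivity) (by positivity),
      Real.logb_mul (by positivity) (by positivity), Real.logb_pow, Real.logb_pow,
      Real.logb_self_eq_one (by norm_num), mul_one, mul_one] at h3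
    have h4 : (q.1 : ℝ) ≤ ((d * q.1 : ℕ) : ℝ) := by exact_mod_cast Nat.le_mul_of_pos_left _ hd
    linarith
  have hk' : (q.1 : ℝ) ≤ (1 + d + Real.logb 2 p.C₁) * l := by
    have : (0 : ℝ) ≤ d := d.cast_nonneg
    nlinarith
  rw [hb] at h1
  calc _ ≤ (q.1 : ℝ) * (2 ^ d * p.nrm) := h1
    _ ≤ (1 + d + Real.logb 2 p.C₁) * l * (2 ^ d * p.nrm) := by gcongr
    _ = growth d p.C₁ * (2 * p.nrm * l) := by unfold growth; ring
    _ ≤ _ := mul_le_mul_of_nonneg_left p.logb_inv_η_le (growth_nonneg d hC)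

lemma J_le_Psi (hp : p.Valid) (hη : p.η < 1 / 2) (q : Cube d) :
    p.J q ≤ p.C₂ * (Real.log p.C₁ + 1) / 2 * p.Psi := by
  have hC := hp.one_le_C₁
  have hC2 := hp.C₂_pos
  have hη0 := hp.η_pos
  have hn := hp.nrm_nonneg
  have hm := q.meas_pos
  have hm1 : q.meas ≤ 1 := by
    rw [q.meas_eq]
    exact pow_le_one₀ (by positivity) (by
      rw [div_le_one (by positivity)]; exact one_le_pow₀ (by norm_num))
  have hlC := Real.log_nonneg hC
  set l := Real.logb 2 (1 / p.η) with hl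
  have hl1 : 1 ≤ l := by
    rw [hl, Real.le_logb_iff_rpow_le (by norm_num) (by positivity), Real.rpow_one,
      le_div_iff₀ hη0]
    linarith
  have h1 : Real.log (p.C₁ * q.meas / p.η) ≤ (Real.log p.C₁ + 1) * l := by
    have e : Real.log (p.C₁ * q.meas / p.η) ≤ Real.log (p.C₁ * (1 / p.η)) := by
      refine Real.log_le_log (by positivity) ?_
      rw [mul_one_div]
      gcongr
      exact mul_le_of_le_one_right (by linarith) hm1
    rw [Real.log_mul (by positivity) (by positivity)] at e
    have := hp.log_le_logb
    nlinarith
  calc _ ≤ p.C₂ * p.nrm * ((Real.log p.C₁ + 1) * l) :=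
        mul_le_mul_of_nonneg_left h1 (by positivity)
    _ = p.C₂ * (Real.log p.C₁ + 1) / 2 * (2 * p.nrm * l) := by ring
    _ ≤ _ := mul_le_mul_of_nonneg_left p.logb_inv_η_le (by positivity)

/-- Refinement makes the containment condition automatic for cells, so the fixed-cube tail bounds
apply to the empirical means. -/
lemma nestedHits_eq_hits {c : ℕ → Cube d} (hc : ∀ t ∈ Finset.Icc 1 p.T, c t ∈ p.partition a t)
    (hac : ∀ t ∈ Finset.Icc 1 p.T, a t ∈ (c t).toSet) {t : ℕ} (ht : t ∈ Finset.Icc 1 p.T)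
    {q : Cube d} (hq : q ∈ p.partition a t) : nestedHits a c t q = hits a t q := by
  classical
  unfold nestedHits hits
  refine Finset.filter_congr fun i hi => ⟨fun h => h.1, fun h => ⟨h, ?_⟩⟩
  have hi' : i ∈ Finset.Icc 1 p.T := by
    rw [Finset.mem_Icc] at *; rw [Finset.mem_Ico] at hi; omega
  exact toSet_subset_of_partition (Finset.mem_Ico.1 hi).2.le (hc i hi') hq (hac i hi') h

/-- Regret of one round in terms of its confidence width, if the confidence intervals are valid. -/
lemma level_sub_le_of_optimistic (hp : p.Valid) (hd : 0 < d) (hf : IsBMO f)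
    (hb : bmoNorm f = p.nrm) (hJN : JohnNirenberg f p.C₁ p.C₂) {t : ℕ} (ht : 1 ≤ t) {c : Cube d}
    (hc : c ∈ p.partition a t) (hopt : ∀ q ∈ p.partition a t, p.U a y t q ≤ p.U a y t c)
    (hconc : ∀ q ∈ p.partition a t, |empMean a y t q - ⨍ x in q.toSet, f x| ≤ p.H a t q)
    {δ z : ℝ} (hδ : (p.partition a t).ncard * p.η < δ) (hz : z ∈ levels f δ) :
    z - ⨍ x in c.toSet, f x ≤ 3 * p.H a t c := by
  obtain ⟨q, hq, hzq⟩ := exists_level_le hp hd hf hb hJN hδ hz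
  have h1 := (abs_le.1 (hconc q hq)).1
  have h2 := (abs_le.1 (hconc c hc)).2
  have h3 := hopt q hq
  have h4 := J_le_H_of_mem_partition ht hc
  unfold Params.U at h3
  -- The chain is `z ≤ ⟨f⟩_q + J(q) ≤ U(q) ≤ U(c) ≤ ⟨f⟩_c + 2 H(c) + J(c) ≤ ⟨f⟩_c + 3 H(c)`.
  linarith

/-- The total regret against a level, on the event that the confidence intervals are valid whenever
they are needed. -/
lemma sum_level_sub_le (hp : p.Valid) (hd : 0 < d) (hf : IsBMO f)
    (hb : bmoNorm f = p.nrm) (hJN : JohnNirenberg f p.C₁ p.C₂) (h0 : ⨍ x in unitCube d, f x = 0)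
    {c : ℕ → Cube d} (hc : ∀ t ∈ Finset.Icc 1 p.T, c t ∈ p.partition a t ∧
      ∀ q ∈ p.partition a t, p.U a y t q ≤ p.U a y t (c t))
    (hac : ∀ t ∈ Finset.Icc 1 p.T, a t ∈ (c t).toSet)
    (hconc : p.η < 1 / 2 → 0 < p.nrm → threshold d p.C₁ p.C₂ p.nrm p.D ≤ p.conf →
      ∀ t ∈ Finset.Icc 1 p.T, ∀ q ∈ p.partition a t,
        |empMean a y t q - ⨍ x in q.toSet, f x| ≤ p.H a t q)
    {δ z : ℝ} (hδ : (p.partition a p.T).ncard * p.η < δ) (hz : z ∈ levels f δ) :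
    ∑ t ∈ Finset.Icc 1 p.T, max 0 (z - ⨍ x in (c t).toSet, f x) ≤
      (6 + Real.exp (threshold d p.C₁ p.C₂ p.nrm p.D ^ 2 / 2) *
        (2 * growth d p.C₁ + p.C₂ * (Real.log p.C₁ + 1) / 2)) *
          (p.Psi + p.D) * p.conf * scatter p.T (p.partition a p.T).ncard := by
  set N := (p.partition a p.T).ncard with hN
  set B := 2 * growth d p.C₁ + p.C₂ * (Real.log p.C₁ + 1) / 2 with hB
  have hC := hp.one_le_C₁
  have hC2 := hp.C₂_pos
  have hB0 : 0 ≤ B := by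
    have := growth_nonneg d hC
    have := Real.log_nonneg hC
    positivity
  have hPsi := hp.Psi_nonneg
  have hD := hp.D_nonneg
  have hconf := hp.one_le_conf
  have hN1 : 1 ≤ N := one_le_ncard_partition hp hd _
  have hsc : 1 ≤ scatter p.T N := one_le_scatter hp.one_le_T hN1
  have hX : 0 ≤ (p.Psi + p.D) * p.conf * scatter p.T N := by positivity
  have hδt : ∀ t ∈ Finset.Icc 1 p.T, ((p.partition a t).ncard : ℝ) * p.η < δ := by
    intro t ht
    refine lt_of_le_of_lt ?_ hδ
    have : ((p.partition a t).ncard : ℝ) ≤ N := by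
      exact_mod_cast ncard_partition_mono hp hd (Finset.mem_Icc.1 ht).2
    exact mul_le_mul_of_nonneg_right this hp.η_pos.le
  have hsumH := sum_H_le hp hd c (fun t ht => (hc t ht).1) hac
  have hofH : (∀ t ∈ Finset.Icc 1 p.T, z - ⨍ x in (c t).toSet, f x ≤ 3 * p.H a t (c t)) →
      ∑ t ∈ Finset.Icc 1 p.T, max 0 (z - ⨍ x in (c t).toSet, f x) ≤
        6 * ((p.Psi + p.D) * p.conf * scatter p.T N) := by
    intro h
    calc _ ≤ ∑ t ∈ Finset.Icc 1 p.T, 3 * p.H a t (c t) := Finset.sum_le_sum fun t ht =>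
          max_le (mul_nonneg (by norm_num) (hp.H_nonneg t _)) (h t ht)
      _ = 3 * ∑ t ∈ Finset.Icc 1 p.T, p.H a t (c t) := by rw [Finset.mul_sum]
      _ ≤ _ := by linarith
  set Z := Real.exp (threshold d p.C₁ p.C₂ p.nrm p.D ^ 2 / 2) with hZ
  have hZ0 : 0 < Z := Real.exp_pos _
  have hgoal : (6 + Z * B) * (p.Psi + p.D) * p.conf * scatter p.T N =
      6 * ((p.Psi + p.D) * p.conf * scatter p.T N) +
        Z * B * ((p.Psi + p.D) * p.conf * scatter p.T N) := by ring
  rw [hgoal]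
  have hX2 : 0 ≤ Z * B * ((p.Psi + p.D) * p.conf * scatter p.T N) :=
    mul_nonneg (mul_nonneg hZ0.le hB0) hX
  -- With a single final cell, `η` may be close to 1 and `Ψ` may be too small to control constants;
  -- but then the optimal cell is the selected one and no concentration is needed.
  rcases hN1.eq_or_lt with hN1 | hN2
  · refine (hofH fun t ht => ?_).trans (by linarith)
    obtain ⟨q, hq, hzq⟩ := exists_level_le hp hd hf hb hJN (hδt t ht) hz
    have hcard : (p.partition a t).ncard = 1 := le_antisymm
      ((ncard_partition_mono hp hd (Finset.mem_Icc.1 ht).2).trans_eq hN1.symm)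
      (one_le_ncard_partition hp hd t)
    obtain ⟨u, hu⟩ := Set.ncard_eq_one.1 hcard
    have hqc : q = c t := by
      have h1 := hq
      have h2 := (hc t ht).1
      rw [hu] at h1 h2
      exact h1.trans h2.symm
    have h4 := J_le_H_of_mem_partition (Finset.mem_Icc.1 ht).1 (hc t ht).1
    have h5 := hp.H_nonneg (a := a) t (c t)
    rw [hqc] at hzq
    linarith
  -- At least two cells together with `N η < δ ≤ 1`.
  · have hη : p.η < 1 / 2 := by
      have h1 : δ ≤ 1 := by
        rw [← (show volume.real {x ∈ unitCube d | z < f x} = δ from hz)]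
        have e : volume.real (unitCube d) = 1 := by
          rw [unitCube_eq_cube, volume_real_cube _ zero_le_one, one_pow]
        rw [← e]
        refine measureReal_mono (fun x hx => hx.1) ?_
        rw [unitCube_eq_cube, volume_cube _ zero_le_one]
        exact ENNReal.ofReal_ne_top
      have h2 : (2 : ℝ) ≤ N := by exact_mod_cast hN2
      have := hp.η_pos
      nlinarith
    by_cases hcase : 0 < p.nrm ∧ threshold d p.C₁ p.C₂ p.nrm p.D ≤ p.conf
    · refine (hofH fun t ht => ?_).trans (by linarith)
      exact level_sub_le_of_optimistic hp hd hf hb hJN (Finset.mem_Icc.1 ht).1 (hc t ht).1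
        (hc t ht).2 (hconc hη hcase.1 hcase.2 t ht) (hδt t ht) hz
    -- Crude bound through the sizes of the averages and of `J`. It vanishes for `‖f‖ = 0`, since
    -- then `Ψ = 0`; otherwise the horizon is at most `Z`.
    · have htriv : ∀ t ∈ Finset.Icc 1 p.T, max 0 (z - ⨍ x in (c t).toSet, f x) ≤ B * p.Psi := by
        intro t ht
        obtain ⟨q, hq, hzq⟩ := exists_level_le hp hd hf hb hJN (hδt t ht) hz
        have h1 := (abs_le.1 (abs_setAverage_le_growth hp hd hf hb h0 hη hq)).2
        have h2 := (abs_le.1 (abs_setAverage_le_growth hp hd hf hb h0 hη (hc t ht).1)).1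
        have h3 := J_le_Psi hp hη q
        refine max_le (by positivity) ?_
        rw [hB]
        linarith
      have hsum : ∑ t ∈ Finset.Icc 1 p.T, max 0 (z - ⨍ x in (c t).toSet, f x) ≤
          p.T * (B * p.Psi) := by
        refine (Finset.sum_le_sum htriv).trans (le_of_eq ?_)
        simp
      have hTP : p.T * (B * p.Psi) ≤ Z * B * p.Psi := by
        rcases hp.nrm_nonneg.eq_or_lt with hn | hn
        · have : p.Psi = 0 := by rw [Params.Psi, ← hn]; simp
          rw [this]; simp
        · have hlt : p.conf < threshold d p.C₁ p.C₂ p.nrm p.D := by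
            by_contra! hge
            exact hcase ⟨hn, hge⟩
          have : (p.T : ℝ) ≤ Z := hp.horizon_le.trans (Real.exp_le_exp.2 (by
            have : p.conf ^ 2 ≤ threshold d p.C₁ p.C₂ p.nrm p.D ^ 2 := by gcongr
            linarith))
          rw [mul_assoc]
          exact mul_le_mul_of_nonneg_right this (by positivity)
      have hPX : p.Psi ≤ (p.Psi + p.D) * p.conf * scatter p.T N := by
        have h1 : 1 ≤ p.conf * scatter p.T N := one_le_mul_of_one_le_of_one_le hconf hsc
        rw [mul_assoc]
        nlinarith
      have := mul_le_mul_of_nonneg_left hPX (mul_nonneg hZ0.le hB0)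
      linarith

end Deterministic

/-! ### Validity of the confidence intervals and the good event. -/

section Concentration

variable {Ω : Type*} {d : ℕ} {p : Params} {f : (Fin d → ℝ) → ℝ} {Q : ℕ → Ω → Cube d}
  {A : ℕ → Ω → Fin d → ℝ} {Y : ℕ → Ω → ℝ}

/-- The event that, with `n` visits to `q`, the signed sum of the centred rewards is too large. -/
def deviation (p : Params) (f : (Fin d → ℝ) → ℝ) (Q : ℕ → Ω → Cube d) (A : ℕ → Ω → Fin d → ℝ)
    (Y : ℕ → Ω → ℝ) (q : Cube d) (t n : ℕ) (σ : ℝ) : Set Ω :=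
  {ω | (nestedHits (fun i => A i ω) (fun i => Q i ω) t q).card = n ∧
    expScale p.C₂ p.nrm p.D * (p.Psi + p.D) * p.conf ≤
      σ * expScale p.C₂ p.nrm p.D / Real.sqrt n *
        ∑ i ∈ nestedHits (fun i => A i ω) (fun i => Q i ω) t q, (Y i ω - ⨍ y in q.toSet, f y)}

/-- Outside the deviation events all confidence intervals are valid. -/
lemma abs_empMean_sub_le (hp : p.Valid) (hd : 0 < d) (hf : IsBMO f) (hb : bmoNorm f = p.nrm)
    (h0 : ⨍ x in unitCube d, f x = 0) (hη : p.η < 1 / 2) (hb0 : 0 < p.nrm)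
    (hS : threshold d p.C₁ p.C₂ p.nrm p.D ≤ p.conf) {ω : Ω}
    (hc : ∀ t ∈ Finset.Icc 1 p.T, Q t ω ∈ p.partition (fun i => A i ω) t)
    (hac : ∀ t ∈ Finset.Icc 1 p.T, A t ω ∈ (Q t ω).toSet)
    (hdev : ω ∉ ⋃ w ∈ cubesBelow d (p.gridSize d) ×ˢ Finset.Icc 1 p.T ×ˢ Finset.Icc 1 p.T ×ˢ
      ({1, -1} : Finset ℝ), deviation p f Q A Y w.1 w.2.1 w.2.2.1 w.2.2.2)
    {t : ℕ} (ht : t ∈ Finset.Icc 1 p.T) {q : Cube d}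
    (hq : q ∈ p.partition (fun i => A i ω) t) :
    |empMean (fun i => A i ω) (fun i => Y i ω) t q - ⨍ x in q.toSet, f x| ≤
      p.H (fun i => A i ω) t q := by
  have hκ := hp.expScale_pos hb0
  have hhits := nestedHits_eq_hits hc hac ht hq
  set n := count (fun i => A i ω) t q with hn
  have hH : p.H (fun i => A i ω) t q = (p.Psi + p.D) * p.conf / Real.sqrt (max 1 (n : ℝ)) := rfl
  -- In an unvisited cell the empirical mean is 0 by default; its interval is valid because the true
  -- mean is at most `growth · Ψ` and `growth ≤ conf`.
  rcases Nat.eq_zero_or_pos n with hn0 | hn1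
  · have hm : empMean (fun i => A i ω) (fun i => Y i ω) t q = 0 := by
      rw [empMean, ← hn, hn0, Nat.cast_zero, div_zero]
    rw [hm, zero_sub, abs_neg, hH, hn0]
    simp only [Nat.cast_zero, max_eq_left zero_le_one, Real.sqrt_one, div_one]
    refine (abs_setAverage_le_growth hp hd hf hb h0 hη hq).trans ?_
    have hg := growth_nonneg d hp.one_le_C₁
    have hgS : growth d p.C₁ ≤ p.conf := by
      refine le_trans ?_ hS
      have := hp.C₂_pos
      have := varProxy_nonneg p.C₂ p.nrm p.D hp.one_le_C₁
      have : 0 ≤ Real.log (2 ^ (d + 1) * p.C₁) := Real.log_nonneg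
        (one_le_mul_of_one_le_of_one_le (one_le_pow₀ (by norm_num)) hp.one_le_C₁)
      unfold threshold
      exact le_add_of_nonneg_left (by positivity)
    have h1 := hp.Psi_nonneg
    have h2 := hp.D_nonneg
    have h3 : growth d p.C₁ * p.Psi ≤ p.conf * p.Psi := by gcongr
    have h4 : 0 ≤ p.conf := hg.trans hgS
    nlinarith
  · have hn' : (1 : ℝ) ≤ n := by exact_mod_cast hn1
    have hsq : 0 < Real.sqrt n := Real.sqrt_pos.2 (by linarith)
    have hnT : n ∈ Finset.Icc 1 p.T := by
      refine Finset.mem_Icc.2 ⟨hn1, ?_⟩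
      have : n ≤ (Finset.Ico 1 t).card := by
        classical exact Finset.card_filter_le _ _
      rw [Nat.card_Ico] at this
      have := (Finset.mem_Icc.1 ht).2
      omega
    set Z := ∑ i ∈ hits (fun i => A i ω) t q, (Y i ω - ⨍ y in q.toSet, f y) with hZ
    have hside : ∀ σ ∈ ({1, -1} : Finset ℝ), σ * Z ≤ (p.Psi + p.D) * p.conf * Real.sqrt n := by
      intro σ hσ
      have hmem : (q, t, n, σ) ∈ cubesBelow d (p.gridSize d) ×ˢ Finset.Icc 1 p.T ×ˢ
          Finset.Icc 1 p.T ×ˢ ({1, -1} : Finset ℝ) := by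
        simp only [Finset.mem_product]
        exact ⟨mem_cubesBelow hp hd hq, ht, hnT, hσ⟩
      have hnot : ω ∉ deviation p f Q A Y q t n σ := fun hd' =>
        hdev (Set.mem_iUnion₂.2 ⟨(q, t, n, σ), hmem, hd'⟩)
      have h1 : ¬ (expScale p.C₂ p.nrm p.D * (p.Psi + p.D) * p.conf ≤
          σ * expScale p.C₂ p.nrm p.D / Real.sqrt n * Z) := fun hle =>
        hnot ⟨by rw [hhits]; rfl, by rw [hhits]; exact hle⟩
      push Not at h1
      have e : σ * expScale p.C₂ p.nrm p.D / Real.sqrt n * Z =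
          expScale p.C₂ p.nrm p.D * (σ * Z / Real.sqrt n) := by ring
      rw [e, mul_assoc] at h1
      have h2 := (lt_of_mul_lt_mul_left h1 hκ.le).le
      rwa [div_le_iff₀ hsq] at h2
    have hZabs : |Z| ≤ (p.Psi + p.D) * p.conf * Real.sqrt n := by
      have h1 := hside 1 (by simp)
      have h2 := hside (-1) (by simp)
      exact abs_le.2 ⟨by linarith, by linarith⟩
    have hmean : empMean (fun i => A i ω) (fun i => Y i ω) t q - ⨍ x in q.toSet, f x = Z / n := by
      rw [empMean, hZ, Finset.sum_sub_distrib, Finset.sum_const, nsmul_eq_mul, sub_div, ← hn]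
      have : ((hits (fun i => A i ω) t q).card : ℝ) = n := rfl
      rw [this, mul_div_assoc, mul_div_cancel₀]
      linarith
    rw [hmean, hH, max_eq_right hn', abs_div, abs_of_pos (by linarith : (0 : ℝ) < n),
      div_le_div_iff₀ (by linarith) hsq]
    calc |Z| * Real.sqrt n ≤ (p.Psi + p.D) * p.conf * Real.sqrt n * Real.sqrt n := by gcongr
      _ = (p.Psi + p.D) * p.conf * n := by
        rw [mul_assoc, Real.mul_self_sqrt (by linarith)]

variable [mΩ : MeasurableSpace Ω] {P : Measure Ω} [IsProbabilityMeasure P]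

lemma IsRun.measure_deviation_le (h : IsRun P p f Q A Y) (hp : p.Valid) (hf : Measurable f)
    (hfl : LocallyIntegrable f volume) (hb : bmoNorm f = p.nrm) (hb0 : 0 < p.nrm)
    (hJN : JohnNirenberg f p.C₁ p.C₂) (q : Cube d) {t n : ℕ} (ht : t ∈ Finset.Icc 1 p.T)
    (hn : 1 ≤ n) {σ : ℝ} (hσ : |σ| = 1) :
    P (deviation p f Q A Y q t n σ) ≤
      ENNReal.ofReal (Real.exp (expScale p.C₂ p.nrm p.D ^ 2 * varProxy p.C₁ p.C₂ p.nrm p.D -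
        expScale p.C₂ p.nrm p.D * (p.Psi + p.D) * p.conf)) := by
  have hκ := hp.expScale_pos hb0
  have hD := hp.D_nonneg
  have hn' : (1 : ℝ) ≤ n := by exact_mod_cast hn
  have hsq : 1 ≤ Real.sqrt n := Real.one_le_sqrt.2 hn'
  -- Scaling by `1/√n` makes the compensator `n s² V` independent of `n`, so all visit numbers obey
  -- the same tail bound.
  set s := σ * expScale p.C₂ p.nrm p.D / Real.sqrt n with hs
  have habs : |s| ≤ expScale p.C₂ p.nrm p.D := by
    rw [hs, abs_div, abs_mul, hσ, one_mul, abs_of_pos hκ, abs_of_pos (by linarith)]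
    exact div_le_self hκ.le hsq
  have hs2 : s ^ 2 * n = expScale p.C₂ p.nrm p.D ^ 2 := by
    have hσ2 : σ ^ 2 = 1 := by rw [← sq_abs, hσ, one_pow]
    rw [hs, div_pow, mul_pow, hσ2, one_mul, Real.sq_sqrt (by linarith)]
    field_simp
  have hV := lintegral_exp_mul_le hp.one_le_C₁ hp.C₂_pos (hb ▸ hb0) hJN hf hfl q (s := s) rfl rfl
    (by rw [hb]; exact habs.trans (min_le_left _ _))
  -- Using `D + 1` in `expScale` covers the noiseless case `D = 0`.
  have hsD : |s| * p.D ≤ 1 := by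
    have h1 : |s| ≤ 1 / (p.D + 1) := habs.trans (min_le_right _ _)
    calc |s| * p.D ≤ 1 / (p.D + 1) * (p.D + 1) := by gcongr; linarith
      _ = 1 := by field_simp
  refine (h.measure_tail_le hf q hV hsD ht n _).trans (le_of_eq ?_)
  congr 3
  rw [← hs2, hb]
  unfold varProxy
  ring

lemma IsRun.measure_iUnion_deviation_le (h : IsRun P p f Q A Y) (hp : p.Valid) (hf : Measurable f)
    (hfl : LocallyIntegrable f volume) (hb : bmoNorm f = p.nrm) (hb0 : 0 < p.nrm)
    (hJN : JohnNirenberg f p.C₁ p.C₂) (hS : threshold d p.C₁ p.C₂ p.nrm p.D ≤ p.conf) :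
    P (⋃ w ∈ cubesBelow d (p.gridSize d) ×ˢ Finset.Icc 1 p.T ×ˢ Finset.Icc 1 p.T ×ˢ
      ({1, -1} : Finset ℝ), deviation p f Q A Y w.1 w.2.1 w.2.2.1 w.2.2.2) ≤
      ENNReal.ofReal (2 * p.ε) := by
  refine (measure_biUnion_finset_le _ _).trans ((Finset.sum_le_card_nsmul _ _
    (ENNReal.ofReal (Real.exp (expScale p.C₂ p.nrm p.D ^ 2 * varProxy p.C₁ p.C₂ p.nrm p.D -
      expScale p.C₂ p.nrm p.D * (p.Psi + p.D) * p.conf))) fun w hw => ?_).trans ?_)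
  · simp only [Finset.mem_product, Finset.mem_insert, Finset.mem_singleton] at hw
    refine h.measure_deviation_le hp hf hfl hb hb0 hJN _ hw.2.1 (Finset.mem_Icc.1 hw.2.2.1).1 ?_
    rcases hw.2.2.2 with e | e <;> simp [e]
  · have hcard : ({1, -1} : Finset ℝ).card = 2 := Finset.card_pair (by norm_num)
    rw [Finset.card_product, Finset.card_product, Finset.card_product, card_cubesBelow, hcard,
      Nat.card_Icc, Nat.add_sub_cancel, nsmul_eq_mul, ← ENNReal.ofReal_natCast,
      ← ENNReal.ofReal_mul (Nat.cast_nonneg _)]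
    refine ENNReal.ofReal_le_ofReal (le_trans (le_of_eq ?_) (hp.union_bound hb0 d hS))
    push_cast
    ring

/-- The regret bound for measurable reward functions, with the conditional mean rewards replaced by
the means over the selected cubes. -/
lemma IsRun.exists_good_event (h : IsRun P p f Q A Y) (hp : p.Valid) (hd : 0 < d)
    (hfm : Measurable f) (hf : IsBMO f) (hb : bmoNorm f = p.nrm) (hJN : JohnNirenberg f p.C₁ p.C₂)
    (h0 : ⨍ x in unitCube d, f x = 0) :
    ∃ B : Set Ω, P B ≤ ENNReal.ofReal (2 * p.ε) ∧ ∀ ω ∉ B, ∀ δ z : ℝ,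
      (p.partition (fun i => A i ω) p.T).ncard * p.η < δ → z ∈ levels f δ →
      ∑ t ∈ Finset.Icc 1 p.T, max 0 (z - (P[fun ω' => f (A t ω') | preArm Q A Y t]) ω) ≤
        (6 + Real.exp (threshold d p.C₁ p.C₂ p.nrm p.D ^ 2 / 2) *
          (2 * growth d p.C₁ + p.C₂ * (Real.log p.C₁ + 1) / 2)) *
          (p.Psi + p.D) * p.conf * scatter p.T (p.partition (fun i => A i ω) p.T).ncard := by
  classical
  let B₀ : Set Ω := {ω | ¬ ∀ t ∈ Finset.Icc 1 p.T, ((Q t ω ∈ p.partition (fun i => A i ω) t ∧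
      ∀ q ∈ p.partition (fun i => A i ω) t, p.U (fun i => A i ω) (fun i => Y i ω) t q ≤
        p.U (fun i => A i ω) (fun i => Y i ω) t (Q t ω)) ∧ A t ω ∈ (Q t ω).toSet) ∧
      (P[fun ω' => f (A t ω') | preArm Q A Y t]) ω = ⨍ x in (Q t ω).toSet, f x}
  have hB₀ : P B₀ = 0 := by
    have : ∀ᵐ ω ∂P, ∀ t ∈ Finset.Icc 1 p.T, ((Q t ω ∈ p.partition (fun i => A i ω) t ∧
      ∀ q ∈ p.partition (fun i => A i ω) t, p.U (fun i => A i ω) (fun i => Y i ω) t q ≤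
        p.U (fun i => A i ω) (fun i => Y i ω) t (Q t ω)) ∧ A t ω ∈ (Q t ω).toSet) ∧
      (P[fun ω' => f (A t ω') | preArm Q A Y t]) ω = ⨍ x in (Q t ω).toSet, f x :=
      (Finset.eventually_all _).2 fun t ht => ((h.optimistic t ht).and (h.arm_mem ht)).and
        (h.condExp_reward hp hd hf.1 hfm ht)
    exact this
  let B₁ : Set Ω := ⋃ w ∈ cubesBelow d (p.gridSize d) ×ˢ Finset.Icc 1 p.T ×ˢ Finset.Icc 1 p.T ×ˢ
      ({1, -1} : Finset ℝ), deviation p f Q A Y w.1 w.2.1 w.2.2.1 w.2.2.2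
  let cond : Prop := 0 < p.nrm ∧ threshold d p.C₁ p.C₂ p.nrm p.D ≤ p.conf
  -- The deviation events are excluded only when the union bound holds; otherwise the deterministic
  -- crude bound takes over. The exceptional set does not depend on `δ` or `z`, so the bound is
  -- simultaneous.
  refine ⟨B₀ ∪ if cond then B₁ else ∅, ?_, fun ω hω δ z hδ hz => ?_⟩
  · refine (measure_union_le _ _).trans ?_
    rw [hB₀, zero_add]
    split_ifs with hcond
    · exact h.measure_iUnion_deviation_le hp hfm hf.1 hb hcond.1 hJN hcond.2
    · simp
  · rw [Set.mem_union, not_or] at hω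
    have hgood := not_not.1 (fun hc => hω.1 hc : ¬¬ ∀ t ∈ Finset.Icc 1 p.T,
      ((Q t ω ∈ p.partition (fun i => A i ω) t ∧
      ∀ q ∈ p.partition (fun i => A i ω) t, p.U (fun i => A i ω) (fun i => Y i ω) t q ≤
        p.U (fun i => A i ω) (fun i => Y i ω) t (Q t ω)) ∧ A t ω ∈ (Q t ω).toSet) ∧
      (P[fun ω' => f (A t ω') | preArm Q A Y t]) ω = ⨍ x in (Q t ω).toSet, f x)
    rw [Finset.sum_congr rfl fun t ht => by rw [(hgood t ht).2]]
    refine sum_level_sub_le (c := fun t => Q t ω) (y := fun i => Y i ω) hp hd hf hb hJN h0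
      (fun t ht => (hgood t ht).1.1) (fun t ht => (hgood t ht).1.2) ?_ hδ hz
    intro hη hb0 hS t ht q hq
    refine abs_empMean_sub_le hp hd hf hb h0 hη hb0 hS (fun t ht => (hgood t ht).1.1.1)
      (fun t ht => (hgood t ht).1.2) ?_ ht hq
    have := hω.2
    rwa [if_pos ⟨hb0, hS⟩] at this

end Concentration

/-! ### Independence of the chosen version of the reward function. -/

section Versions

variable {d : ℕ} {f g : (Fin d → ℝ) → ℝ}

lemma setAverage_congr_of_ae_eq (h : f =ᵐ[volume] g) (s : Set (Fin d → ℝ)) :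
    ⨍ x in s, f x = ⨍ x in s, g x := average_congr (ae_restrict_of_ae h)

lemma oscillationBound_congr (h : f =ᵐ[volume] g) (C : ℝ) :
    OscillationBound f C ↔ OscillationBound g C := by
  have e : ∀ s : Set (Fin d → ℝ), ⨍ x in s, |f x - ⨍ y in s, f y| = ⨍ x in s, |g x - ⨍ y in s, g y| := by
    intro s
    rw [setAverage_congr_of_ae_eq h s]
    exact setAverage_congr_of_ae_eq (h.mono fun x hx => by simp only [hx]) s
  unfold OscillationBound
  simp only [e]

lemma bmoNorm_congr (h : f =ᵐ[volume] g) : bmoNorm f = bmoNorm g := by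
  unfold bmoNorm
  simp only [oscillationBound_congr h]

lemma IsBMO.congr (hf : IsBMO f) (h : f =ᵐ[volume] g) : IsBMO g := by
  refine ⟨hf.1.congr h, ?_⟩
  obtain ⟨C, hC⟩ := hf.2
  exact ⟨C, (oscillationBound_congr h C).1 hC⟩

lemma JohnNirenberg.congr {C₁ C₂ : ℝ} (hf : JohnNirenberg f C₁ C₂) (h : f =ᵐ[volume] g) :
    JohnNirenberg g C₁ C₂ := by
  intro a l hl r hr
  rw [← setAverage_congr_of_ae_eq h, ← bmoNorm_congr h]
  refine (le_of_eq (measureReal_congr ?_)).trans (hf a l hl r hr)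
  filter_upwards [h] with x hx
  change (_ ∧ _) = (_ ∧ _)
  simp only [hx]

lemma levels_congr (h : f =ᵐ[volume] g) (δ : ℝ) : levels f δ = levels g δ := by
  ext z
  have : volume.real {a ∈ unitCube d | z < f a} = volume.real {a ∈ unitCube d | z < g a} := by
    refine measureReal_congr ?_
    filter_upwards [h] with x hx
    change (_ ∧ _) = (_ ∧ _)
    simp only [hx]
  change _ = δ ↔ _ = δ
  rw [this]

variable {Ω : Type*} [mΩ : MeasurableSpace Ω] {P : Measure Ω} [IsProbabilityMeasure P]
  {p : Params} {Q : ℕ → Ω → Cube d} {A : ℕ → Ω → Fin d → ℝ} {Y : ℕ → Ω → ℝ}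

lemma IsRun.ae_eq_comp_arm (hr : IsRun P p f Q A Y) (h : f =ᵐ[volume] g) {t : ℕ}
    (ht : t ∈ Finset.Icc 1 p.T) : (fun ω => f (A t ω)) =ᵐ[P] fun ω => g (A t ω) :=
  ae_of_ae_map (hr.measurable_arm t).aemeasurable ((hr.map_arm_absolutelyContinuous ht).ae_le h)

lemma IsRun.congr (hr : IsRun P p f Q A Y) (h : f =ᵐ[volume] g) : IsRun P p g Q A Y where
  measurable_cube := hr.measurable_cube
  measurable_arm := hr.measurable_arm
  measurable_reward := hr.measurable_reward
  optimistic := hr.optimistic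
  uniform := hr.uniform
  noise_bounded t ht := by
    filter_upwards [hr.noise_bounded t ht, hr.ae_eq_comp_arm h ht] with ω h1 h2
    rwa [← h2]
  noise_centered t ht := by
    refine (condExp_congr_ae ?_).trans (hr.noise_centered t ht)
    filter_upwards [hr.ae_eq_comp_arm h ht] with ω h2
    rw [h2]

end Versions

lemma EReal_sum_le_coe_sum {ι : Type*} (s : Finset ι) {r : ι → EReal} {x : ι → ℝ}
    (h : ∀ i ∈ s, r i ≤ (x i : EReal)) : ∑ i ∈ s, r i ≤ ((∑ i ∈ s, x i : ℝ) : EReal) := by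
  classical
  induction s using Finset.induction_on with
  | empty => simp
  | insert i s hi ih =>
    rw [Finset.sum_insert hi, Finset.sum_insert hi, EReal.coe_add]
    exact add_le_add (h i (Finset.mem_insert_self i s))
      (ih fun j hj => h j (Finset.mem_insert_of_mem hj))

end BMOBandit

/-! ### Assembly of the theorem. -/

theorem mainTheorem1 (d : ℕ) (hd : 0 < d) :
    -- the John-Nirenberg constants that the algorithm needs exist and depend only on `d`
    (∃ C₁ C₂ : ℝ, 1 ≤ C₁ ∧ 0 < C₂ ∧
      ∀ f : (Fin d → ℝ) → ℝ, BMOBandit.IsBMO f → BMOBandit.JohnNirenberg f C₁ C₂) ∧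
    -- regret bound; `K` depends only on `d`, `C₁`, `C₂`, the BMO norm `b` and the noise bound `D`
    (∀ C₁ C₂ b D : ℝ, 1 ≤ C₁ → 0 < C₂ → 0 ≤ b → 0 ≤ D →
      ∃ K : ℝ, ∀ f : (Fin d → ℝ) → ℝ,
        BMOBandit.IsBMO f → BMOBandit.bmoNorm f = b → BMOBandit.JohnNirenberg f C₁ C₂ →
        ⨍ x in BMOBandit.unitCube d, f x = 0 →
        ∀ (ε η : ℝ) (T : ℕ), 0 < ε → ε < 1 → 0 < η → η < 1 → 1 ≤ T →
        ∀ p : BMOBandit.Params, p = ⟨C₁, C₂, b, D, ε, η, T⟩ →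
        ∀ (Ω : Type*) [MeasurableSpace Ω] (P : Measure Ω) [IsProbabilityMeasure P]
          (Q : ℕ → Ω → BMOBandit.Cube d) (A : ℕ → Ω → Fin d → ℝ) (Y : ℕ → Ω → ℝ),
          BMOBandit.IsRun P p f Q A Y →
          ∃ G : Set Ω, MeasurableSet G ∧ ENNReal.ofReal (1 - 2 * ε) ≤ P G ∧
            ∀ ω ∈ G, ∀ N : ℕ, N = (p.partition (fun i => A i ω) T).ncard →
              ∀ δ : ℝ, BMOBandit.Admissible f δ → (N : ℝ) * η < δ →
                ∑ t ∈ Finset.Icc 1 T, BMOBandit.regret P f Q A Y δ t ω ≤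
                  ((K * (p.Psi + D) * Real.sqrt (2 * Real.log (2 * (T : ℝ) ^ 2 / ε)) *
                    Real.sqrt ((T : ℝ) * N *
                      Real.log (1 + (Real.exp 1 - 1) * (T : ℝ) / N)) : ℝ) : EReal)) := by
  refine ⟨BMOBandit.exists_johnNirenberg d, fun C₁ C₂ b D hC₁ hC₂ hb hD => ?_⟩
  refine ⟨6 + Real.exp (BMOBandit.threshold d C₁ C₂ b D ^ 2 / 2) *
    (2 * BMOBandit.growth d C₁ + C₂ * (Real.log C₁ + 1) / 2), ?_⟩
  intro f hf hbf hJN h0 ε η T hε hε1 hη hη1 hT p hp Ω _ P _ Q A Y hrun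
  have hv : p.Valid := by
    subst hp
    exact ⟨hC₁, hC₂, hb, hD, hε, hε1, hη, hη1, hT⟩
  have hae := hf.1.aestronglyMeasurable.ae_eq_mk
  set g := hf.1.aestronglyMeasurable.mk f with hg
  have hrun' := hrun.congr hae
  obtain ⟨B, hPB, hB⟩ := hrun'.exists_good_event hv hd
    hf.1.aestronglyMeasurable.stronglyMeasurable_mk.measurable (hf.congr hae)
    (by rw [← BMOBandit.bmoNorm_congr hae, hbf, hp]) (by rw [hp]; exact hJN.congr hae)
    (by rw [← BMOBandit.setAverage_congr_of_ae_eq hae, h0])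
  let B' : Set Ω := {ω | ¬ ∀ t ∈ Finset.Icc 1 T,
    (P[fun ω' => f (A t ω') | BMOBandit.preArm Q A Y t]) ω =
      (P[fun ω' => g (A t ω') | BMOBandit.preArm Q A Y t]) ω}
  have hB' : P B' = 0 := by
    have : ∀ᵐ ω ∂P, ∀ t ∈ Finset.Icc 1 T,
        (P[fun ω' => f (A t ω') | BMOBandit.preArm Q A Y t]) ω =
          (P[fun ω' => g (A t ω') | BMOBandit.preArm Q A Y t]) ω :=
      (Finset.eventually_all _).2 fun t ht =>
        condExp_congr_ae (hrun.ae_eq_comp_arm hae (by rw [hp]; exact ht))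
    exact this
  -- Passing to a measurable hull of the bad set gives a measurable good event without changing the
  -- probability bound.
  refine ⟨(toMeasurable P (B ∪ B'))ᶜ, (measurableSet_toMeasurable P _).compl, ?_, ?_⟩
  · rw [prob_compl_eq_one_sub (measurableSet_toMeasurable P _), measure_toMeasurable,
      ENNReal.ofReal_sub _ (by positivity), ENNReal.ofReal_one]
    refine tsub_le_tsub_left ((measure_union_le _ _).trans ?_) _
    rw [hB', add_zero]
    exact hPB.trans_eq (by rw [hp])
  · intro ω hω N hN δ hδ hNδ
    have hω' : ω ∉ B ∪ B' := fun h => hω (subset_toMeasurable P _ h)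
    rw [Set.mem_union, not_or] at hω'
    have hcond := not_not.1 (fun hc => hω'.2 hc : ¬¬ ∀ t ∈ Finset.Icc 1 T,
      (P[fun ω' => f (A t ω') | BMOBandit.preArm Q A Y t]) ω =
        (P[fun ω' => g (A t ω') | BMOBandit.preArm Q A Y t]) ω)
    obtain ⟨z, hz⟩ := hδ.2
    -- The benchmark may be `-∞`, but any level dominates it and the regret bound holds for every
    -- real level.
    have hbench : BMOBandit.benchmark f δ ≤ (z : EReal) := sInf_le ⟨z, hz, rfl⟩
    have hpT : p.T = T := by rw [hp]
    have hpη : p.η = η := by rw [hp]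
    have hsum := hB ω hω'.1 δ z (by rw [hpT, hpη, ← hN]; exact hNδ)
      (by rwa [← BMOBandit.levels_congr hae])
    refine (BMOBandit.EReal_sum_le_coe_sum (x := fun t => max 0 (z -
      (P[fun ω' => g (A t ω') | BMOBandit.preArm Q A Y t]) ω)) _ fun t ht => ?_).trans ?_
    · rw [BMOBandit.regret, hcond t ht, EReal.coe_strictMono.monotone.map_max, EReal.coe_sub, EReal.coe_zero]
      exact max_le_max le_rfl (EReal.sub_le_sub hbench le_rfl)
    · rw [EReal.coe_le_coe_iff]
      rw [hpT] at hsum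
      refine hsum.trans (le_of_eq ?_)
      rw [← hN, BMOBandit.Params.conf, BMOBandit.scatter, hp]
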